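/- Let $G=(V,E)$ be a finite undirected graph, $d(v)$ the degree of $v$, $\mathrm{vol}(S)=\sum_{v\in S}d(v)$, $\phi(S)=|E(S,V\setminus S)|/\min(\mathrm{vol}(S),\mathrm{vol}(V\setminus S))$; for $B\subseteq V$ let $\mathrm{vol}_B(T)$ be the volume of $T\subseteq B$ in the subgraph $G[B]$ induced on $B$, and let $\phi_S(B)$ be the minimum conductance of a cut $(T,B\setminus T)$, $\emptyset\ne T\subsetneq B$, in $G[B]$. Logarithms are natural. **Algorithm.** $\mathrm{CRD}(G,v_s,\phi,\tau,t)$: put $m(v_s)=d(v_s)$ and $m(v)=0$ for $v\neq v_s$. For $j=0,\dots,t$: double all masses; call CRD-inner; replace $m(v)$ by $\min(m(v),d(v))$ for all $v$; if $\sum_v m(v)\le\tau\cdot 2d(v_s)2^j$, return $m$ and stop. After iteration $t$ return $m$. CRD-inner: put $h=3\log|m|/\phi$ with $|m|=\sum_v m(v)$, labels $l(v)=0$, arc flows $m(v,u)=0$, and let the current edge of every $v$ be the first one in its list of incident edges. A vertex is active if $l(v)<h$ and $\mathrm{ex}(v)=\max(m(v)-d(v),0)>0$. While there are active vertices, select an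 active $v$ of lowest label, with current edge $\{v,u\}$. If $l(v)>l(u)$ and $r=\min(l(v),1/\phi)-m(v,u)>0$, push $\min(\mathrm{ex}(v),r,2d(u)-m(u))$ units of mass from $v$ to $u$ (updating $m(v),m(u)$, $m(v,u)$ and $m(u,v)=-m(v,u)$); otherwise move to the next edge of $v$, or, if the current edge is the last one, increase $l(v)$ by $1$ and return to the first edge of $v$. Time is counted as one unit per iteration of the while loop, plus, for each iteration $j$, one unit, one unit per vertex carrying mass, and one unit per edge incidence at a vertex whose label is positive at the end of the call (the search for a cut among the level sets of the labels). **Theorem.** There are absolute constants $c_0,T_0>0$ such that for every $0<c_1\le c_0$ there are $s_0,K>0$, depending only on $c_1$, with the following property. Let $B\subseteq V$ satisfy $\mathrm{vol}(B)\le\mathrm{vol}(G)/2$ and $0<\phi_S(B)<1$, and let $\sigma_1,\sigma_2\ge s_0$ be such that 1. $\phi_S(B)/\phi(B)\ge\sigma_1$, and 2. every $T\subseteq B$ with $\mathrm{vol}_B(T)\le\mathrm{vol}_B(B)/2$ satisfies $$\frac{|E(T,B\setminus T)|}{|E(T,V\setminus B)|\,\log\mathrm{vol}(B)\,\log\frac1{\phi_S(B)}}\ge\sigma_2$$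 (a ratio counts as $+\infty$ if $\phi(B)=0$, respectively $|E(T,V\setminus B)|=0$). Let $\sigma=\min(\sigma_1,\sigma_2)$. Let $v_s\in B$, $c_1\phi_S(B)\le\phi\le c_0\phi_S(B)$, $\tau=\frac12$, and let $t\ge T_0\log\frac{\mathrm{vol}(B)}{d(v_s)}$ be an integer. Then, for every order of the edge lists and every choice among the active vertices of lowest label, whenever the CRD algorithm returns $m$, the set $S=\{v: m(v)\ge d(v)\}$ satisfies $$\mathrm{vol}(S\setminus B)\le\frac K\sigma\,\mathrm{vol}(B),\qquad \mathrm{vol}(B\setminus S)\le\frac K\sigma\,\mathrm{vol}(B).$$ The algorithm never gets stuck before it returns, and if $1/\phi$ is an integer (so that all edge capacities and all amounts of mass are integers), then it returns after at most $K\,\mathrm{vol}(B)\log\mathrm{vol}(B)/\phi_S(B)$ units of time. -/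

import Mathlib

noncomputable section

namespace CRD

/-! ### Volumes, cuts and conductances -/

/-- `vol(S)`: the sum of the degrees of the vertices of `S`. -/
def vol {V : Type*} [Fintype V] [DecidableEq V] (G : SimpleGraph V) [DecidableRel G.Adj]
    (S : Finset V) : ℕ :=
  ∑ v ∈ S, G.degree v

/-- `|E(S, T)|`, the number of edges between `S` and `T`; only used for disjoint `S` and `T`. -/
def cut {V : Type*} [DecidableEq V] (G : SimpleGraph V) [DecidableRel G.Adj]
    (S T : Finset V) : ℕ :=
  (G.interedges S T).card

/-- `vol_B(T)` for `T ⊆ B`: the sum of the degrees of the vertices of `T` in the subgraph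
induced on `B`. -/
def volIn {V : Type*} [Fintype V] [DecidableEq V] (G : SimpleGraph V) [DecidableRel G.Adj]
    (B T : Finset V) : ℕ :=
  ∑ v ∈ T, (G.neighborFinset v ∩ B).card

/-- The cut conductance `φ(S)` of `S` in `G`. -/
def conductance {V : Type*} [Fintype V] [DecidableEq V] (G : SimpleGraph V) [DecidableRel G.Adj]
    (S : Finset V) : ℝ :=
  (cut G S Sᶜ : ℝ) / min (vol G S : ℝ) (vol G Sᶜ : ℝ)

/-- The set conductance `φ_S(B)`: the minimum, over the nonempty proper subsets `T` of `B`, of the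
conductance of the cut `(T, B \ T)` in the subgraph induced on `B`. It is `0` if that subgraph is
disconnected, and (by convention) if `B` has at most one vertex. -/
def setConductance {V : Type*} [Fintype V] [DecidableEq V] (G : SimpleGraph V)
    [DecidableRel G.Adj] (B : Finset V) : ℝ :=
  sInf ((fun T : Finset V =>
      (cut G T (B \ T) : ℝ) / min (volIn G B T : ℝ) (volIn G B (B \ T) : ℝ)) ''
    {T : Finset V | T.Nonempty ∧ T ⊂ B})

/-- `σ₁` witnesses that the internal connectivity of `B` dominates its conductance:
`φ_S(B) / φ(B) ≥ σ₁`, where the ratio is `+∞` if `φ(B) = 0`. -/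
def InternallyConnected {V : Type*} [Fintype V] [DecidableEq V] (G : SimpleGraph V)
    [DecidableRel G.Adj] (B : Finset V) (σ₁ : ℝ) : Prop :=
  σ₁ * conductance G B ≤ setConductance G B

/-- The smoothness condition with parameter `σ₂`: for `T ⊆ B` with `vol_B(T) ≤ vol_B(B) / 2`,
`|E(T, B \ T)| / (|E(T, V \ B)| log vol(B) log (1 / φ_S(B))) ≥ σ₂`,
where the ratio is `+∞` if no edge leaves `B` from `T`. -/
def Smooth {V : Type*} [Fintype V] [DecidableEq V] (G : SimpleGraph V)
    [DecidableRel G.Adj] (B : Finset V) (σ₂ : ℝ) : Prop :=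
  ∀ T : Finset V, T ⊆ B → (volIn G B T : ℝ) ≤ (volIn G B B : ℝ) / 2 →
    σ₂ * ((cut G T Bᶜ : ℝ) * Real.log (vol G B) * Real.log (1 / setConductance G B)) ≤
      (cut G T (B \ T) : ℝ)

/-! ### The inner procedure -/

/-- `adj v` lists the neighbours of `v` in `G`, each once, in an arbitrary order. -/
def IsAdjacencyList {V : Type*} (G : SimpleGraph V) (adj : V → List V) : Prop :=
  ∀ v, (adj v).Nodup ∧ ∀ u, u ∈ adj v ↔ G.Adj v u

/-- A state of the inner procedure. -/
structure InnerState (V : Type*) where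
  /-- the mass `m(v)` on each vertex -/
  mass : V → ℝ
  /-- the net mass `m(v, u)` pushed along each arc during the current call -/
  flow : V → V → ℝ
  /-- the label `l(v)` -/
  label : V → ℕ
  /-- the position of the current edge of `v` in its list of incident edges -/
  current : V → ℕ
  /-- the label limit `h` -/
  limit : ℝ

/-- The state in which a call with masses `m` and parameter `φ` starts; `h = 3 log |m| / φ`. -/
def InnerState.init {V : Type*} [Fintype V] (φ : ℝ) (m : V → ℝ) : InnerState V where
  mass := m
  flow := fun _ _ => 0
  label := fun _ => 0
  current := fun _ => 0
  limit := 3 * Real.log (∑ v, m v) / φ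

/-- The excess `ex(v) = max (m(v) - d(v)) 0`. -/
def excess {V : Type*} [Fintype V] (G : SimpleGraph V) [DecidableRel G.Adj]
    (s : InnerState V) (v : V) : ℝ :=
  max (s.mass v - G.degree v) 0

/-- `v` is active, that is, in the queue `Q`: it has excess and its label is below the limit. -/
def IsActive {V : Type*} [Fintype V] (G : SimpleGraph V) [DecidableRel G.Adj]
    (s : InnerState V) (v : V) : Prop :=
  (s.label v : ℝ) < s.limit ∧ 0 < excess G s v

/-- `v` is an active vertex of lowest label. -/
def IsLowestActive {V : Type*} [Fintype V] (G : SimpleGraph V) [DecidableRel G.Adj]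
    (s : InnerState V) (v : V) : Prop :=
  IsActive G s v ∧ ∀ w, IsActive G s w → s.label v ≤ s.label w

/-- The residual capacity `min (l(v)) (1/φ) - m(v, u)` of the arc `(v, u)`. -/
def residual {V : Type*} (φ : ℝ) (s : InnerState V) (v u : V) : ℝ :=
  min (s.label v : ℝ) (1 / φ) - s.flow v u

/-- The arc `(v, u)` is eligible: it is downhill and has positive residual capacity. -/
def IsEligible {V : Type*} (φ : ℝ) (s : InnerState V) (v u : V) : Prop :=
  s.label u < s.label v ∧ 0 < residual φ s v u

/-- The amount `ψ` that a push along `(v, u)` moves. -/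
def pushAmount {V : Type*} [Fintype V] (G : SimpleGraph V) [DecidableRel G.Adj] (φ : ℝ)
    (s : InnerState V) (v u : V) : ℝ :=
  min (excess G s v) (min (residual φ s v u) (2 * G.degree u - s.mass u))

/-- The state after `ψ` units of mass are moved along the arc `(v, u)`. -/
def InnerState.move {V : Type*} [DecidableEq V] (s : InnerState V) (v u : V) (ψ : ℝ) :
    InnerState V :=
  { s with
    mass := fun a => if a = v then s.mass v - ψ else if a = u then s.mass u + ψ else s.mass a
    flow := fun a b =>
      if a = v ∧ b = u then s.flow v u + ψ
      else if a = u ∧ b = v then s.flow u v - ψ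
      else s.flow a b }

/-- One iteration of the while loop of the inner procedure: some active vertex `v` of lowest label
is selected and its current arc is inspected; if it is eligible, mass is pushed along it, otherwise
the current arc of `v` advances, or, at the end of the list of `v`, the vertex `v` is relabeled. -/
inductive InnerStep {V : Type*} [Fintype V] [DecidableEq V] (G : SimpleGraph V)
    [DecidableRel G.Adj] (adj : V → List V) (φ : ℝ) : InnerState V → InnerState V → Prop
  | push (s : InnerState V) (v u : V) (hv : IsLowestActive G s v)
      (hu : (adj v)[s.current v]? = some u) (he : IsEligible φ s v u) :
      InnerStep G adj φ s (s.move v u (pushAmount G φ s v u))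
  | advance (s : InnerState V) (v : V) (hv : IsLowestActive G s v)
      (he : ∀ u, (adj v)[s.current v]? = some u → ¬ IsEligible φ s v u)
      (hlt : s.current v + 1 < (adj v).length) :
      InnerStep G adj φ s { s with current := Function.update s.current v (s.current v + 1) }
  | relabel (s : InnerState V) (v : V) (hv : IsLowestActive G s v)
      (he : ∀ u, (adj v)[s.current v]? = some u → ¬ IsEligible φ s v u)
      (hge : (adj v).length ≤ s.current v + 1) :
      InnerStep G adj φ s
        { s with
          label := Function.update s.label v (s.label v + 1)
          current := Function.update s.current v 0 }

/-! ### The CRD algorithm -/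

/-- A configuration of the CRD algorithm: inside the call of the inner procedure in iteration `j`,
or terminated with returned masses `m`. -/
inductive Config (V : Type*) where
  | inner (j : ℕ) (s : InnerState V)
  | done (m : V → ℝ)

/-- The masses after the removal of the excess: `min (m(v)) (d(v))`. -/
def truncate {V : Type*} [Fintype V] (G : SimpleGraph V) [DecidableRel G.Adj]
    (m : V → ℝ) : V → ℝ :=
  fun v => min (m v) (G.degree v)

/-- The configuration at the start of iteration `0`: the mass `d(v_s)` on `v_s` has been doubled. -/
def start {V : Type*} [Fintype V] [DecidableEq V] (G : SimpleGraph V) [DecidableRel G.Adj]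
    (vs : V) (φ : ℝ) : Config V :=
  .inner 0 (.init φ (fun v => 2 * (if v = vs then (G.degree vs : ℝ) else 0)))

open Classical in
/-- The work done outside the while loop in one iteration of the algorithm: every vertex that
carries mass is touched (excess removal, summation, doubling, initialization of the next call),
and so is every edge at a vertex of positive label (search for a cut among the level cuts). -/
def overhead {V : Type*} [Fintype V] (G : SimpleGraph V) [DecidableRel G.Adj]
    (s : InnerState V) : ℕ :=
  1 + (Finset.univ.filter (fun v => 0 < s.mass v)).card
    + ∑ v ∈ Finset.univ.filter (fun v => 0 < s.label v), G.degree v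

/-- `Step … c n c'`: the algorithm with parameters `φ`, `τ`, `t` can go from `c` to `c'` in one
step, which takes `n` units of time. An iteration of the while loop of the inner procedure takes one
unit. When no vertex is active, the inner procedure ends, the excess is removed, and the algorithm
returns if at most `τ (2 d(v_s) 2 ^ j)` mass is left or if `j = t`; otherwise it doubles the masses
and calls the inner procedure again. -/
inductive Step {V : Type*} [Fintype V] [DecidableEq V] (G : SimpleGraph V) [DecidableRel G.Adj]
    (adj : V → List V) (vs : V) (φ τ : ℝ) (t : ℕ) : Config V → ℕ → Config V → Prop
  | inner (j : ℕ) (s s' : InnerState V) (h : InnerStep G adj φ s s') :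
      Step G adj vs φ τ t (.inner j s) 1 (.inner j s')
  | next (j : ℕ) (s : InnerState V) (hQ : ∀ v, ¬ IsActive G s v)
      (hm : τ * (2 * G.degree vs * 2 ^ j) < ∑ v, truncate G s.mass v) (hj : j < t) :
      Step G adj vs φ τ t (.inner j s) (overhead G s)
        (.inner (j + 1) (.init φ (fun v => 2 * truncate G s.mass v)))
  | finish (j : ℕ) (s : InnerState V) (hQ : ∀ v, ¬ IsActive G s v)
      (hm : ∑ v, truncate G s.mass v ≤ τ * (2 * G.degree vs * 2 ^ j) ∨ t ≤ j) :
      Step G adj vs φ τ t (.inner j s) (overhead G s) (.done (truncate G s.mass))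

/-- `Run … n c`: some execution of the algorithm from its start reaches `c` after `n` units of
time. -/
inductive Run {V : Type*} [Fintype V] [DecidableEq V] (G : SimpleGraph V) [DecidableRel G.Adj]
    (adj : V → List V) (vs : V) (φ τ : ℝ) (t : ℕ) : ℕ → Config V → Prop
  | start : Run G adj vs φ τ t 0 (start G vs φ)
  | step (n k : ℕ) (c c' : Config V) (h : Run G adj vs φ τ t n c)
      (hs : Step G adj vs φ τ t c k c') : Run G adj vs φ τ t (n + k) c'

open Classical in
/-- The recovered cluster `S = {v | m(v) ≥ d(v)}`. -/
def recovered {V : Type*} [Fintype V] (G : SimpleGraph V) [DecidableRel G.Adj]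
    (m : V → ℝ) : Finset V :=
  Finset.univ.filter (fun v => (G.degree v : ℝ) ≤ m v)

end CRD

end

set_option linter.unusedSectionVars false

namespace CRD

/-! Within one call of the inner procedure the labels act as potentials. A vertex is relabelled only
after all its edges have been scanned, so an edge along which the label drops by two or more is
nearly saturated (`steep`), and a vertex of positive label holds at least its degree (`full`).
Conservation of mass on a level set of the labels then bounds its cut by a volume or mass term plus
the short edges, along which the label drops by exactly 1. Short edges out of one level set end in
the layer just below it, so they either force the level sets to grow or add up by telescoping.

Saturation (`InnerInv.label_pos`): if some vertex of `B` ends with excess, its label has reached `h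
= 3 log |m| / φ`. Expansion of `B` makes the level sets grow geometrically while they hold at most
half of `B`, and makes their complements grow geometrically afterwards. Both phases must end before
level 0, since labelled vertices are full and the total mass is `|m|`; hence all of `B` is labelled,
and so full.

Leakage: an edge leaving `B` carries at most `1/φ`, which bounds the loss of a late iteration by
`|E(B, V \ B)| / φ` (`InnerInv.outflow_le_cut_div`). While the mass is at most half of the volume of
`B`, smoothness compares the boundary of each level set with its cut inside `B`, and these cuts sum
to at most `|m| (4 + log (1/φ))` by a harmonic sum (`InnerInv.sum_level_cut_le`). There are `O(log
vol(B))` early iterations, and the relative losses of the late ones form a geometric series, so the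
total leaked fraction is `O(1/σ)` (`sum_leakFrac_le`).

To absorb the constant in `4 + log (1/φ)` into a multiple of `log (1/φ_S(B))`, the latter must be
bounded away from 0: a set conductance below 1 is at most 79/80 (`setConductance_le`).

Over the iterations (`RoundInv`), `B` is either saturated or has kept almost all the mass it would
have without removals. The second case is incompatible with stopping, so `B` lies inside the
recovered set; the volume recovered outside is at most the leaked mass. The time bound comes from a
potential built from labels, current edges and excess (`TimeInv`), summed over geometrically growing
masses. -/

/-- The indicator of adjacency as a real number. -/
noncomputable def adjInd {V : Type*} (G : SimpleGraph V) [DecidableRel G.Adj] (v u : V) : ℝ :=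
  if G.Adj v u then 1 else 0

/-! ### Invariants of the inner procedure -/

section Inner

variable {V : Type*} [Fintype V] [DecidableEq V] (G : SimpleGraph V) [DecidableRel G.Adj]

theorem adjInd_nonneg (v u : V) : 0 ≤ adjInd G v u := by
  unfold adjInd; split_ifs <;> norm_num

theorem adjInd_le_one (v u : V) : adjInd G v u ≤ 1 := by
  unfold adjInd; split_ifs <;> norm_num

theorem adjInd_comm (v u : V) : adjInd G v u = adjInd G u v := by
  unfold adjInd; simp only [G.adj_comm]

/-- The invariants of the inner procedure started with the masses `m₀`. -/
structure InnerInv (adj : V → List V) (φ : ℝ) (m₀ : V → ℝ) (s : InnerState V) : Prop where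
  limit_eq : s.limit = 3 * Real.log (∑ v, m₀ v) / φ
  mass_nonneg : ∀ v, 0 ≤ s.mass v
  mass_le : ∀ v, s.mass v ≤ 2 * G.degree v
  antisymm : ∀ v u, s.flow v u = - s.flow u v
  flow_le : ∀ v u, s.flow v u ≤ adjInd G v u * min (s.label v : ℝ) (1 / φ)
  mass_eq : ∀ v, s.mass v = m₀ v - ∑ u, s.flow v u
  full : ∀ v, 0 < s.label v ∨ 0 < s.current v → (G.degree v : ℝ) ≤ s.mass v
  scanned : ∀ v p u, p < s.current v → (adj v)[p]? = some u →
    s.label v ≤ s.label u ∨ min (s.label v : ℝ) (1 / φ) ≤ s.flow v u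
  steep : ∀ v u, G.Adj v u → s.label u + 2 ≤ s.label v →
    min ((s.label v : ℝ) - 1) (1 / φ) ≤ s.flow v u
  label_le : ∀ v, s.label v = 0 ∨ (s.label v : ℝ) < s.limit + 1
  current_le : ∀ v, s.current v = 0 ∨ s.current v + 1 ≤ G.degree v

theorem InnerInv.init (adj : V → List V) (φ : ℝ) (m₀ : V → ℝ) (hφ : 0 < φ) (h0 : ∀ v, 0 ≤ m₀ v)
    (h2 : ∀ v, m₀ v ≤ 2 * G.degree v) : InnerInv G adj φ m₀ (.init φ m₀) where
  limit_eq := rfl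
  mass_nonneg := h0
  mass_le := h2
  antisymm := by simp [InnerState.init]
  flow_le v u := by
    simp only [InnerState.init, Nat.cast_zero]
    exact mul_nonneg (adjInd_nonneg G v u) (le_min le_rfl (by positivity))
  mass_eq := by simp [InnerState.init]
  full := by simp [InnerState.init]
  scanned := by simp [InnerState.init]
  steep := by simp [InnerState.init]
  label_le := by simp [InnerState.init]
  current_le := by simp [InnerState.init]

variable {G}

/-- A lower vertex with excess would itself be active and would have been selected first. This is
the only use of the lowest-label rule. -/
theorem mass_le_of_lower {s : InnerState V} {v u : V} (hv : IsLowestActive G s v)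
    (hl : s.label u < s.label v) : s.mass u ≤ G.degree u := by
  by_contra hcon
  push Not at hcon
  have hact : IsActive G s u := by
    refine ⟨lt_trans (by exact_mod_cast hl) hv.1.1, ?_⟩
    unfold excess
    exact lt_max_of_lt_left (by linarith)
  exact absurd (hv.2 u hact) (by omega)

theorem degree_lt_mass_of_isActive {s : InnerState V} {v : V} (hv : IsActive G s v) :
    (G.degree v : ℝ) < s.mass v := by
  have := hv.2
  unfold excess at this
  rcases lt_max_iff.1 this with h | h
  · linarith
  · exact absurd h (lt_irrefl _)

theorem excess_eq_of_isActive {s : InnerState V} {v : V} (hv : IsActive G s v) :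
    excess G s v = s.mass v - G.degree v := by
  unfold excess
  exact max_eq_left (by linarith [degree_lt_mass_of_isActive hv])

/-- The term `2 d(u) - m(u)` never blocks a push, because the target lies lower and so holds at most
its degree. -/
theorem pushAmount_pos {φ : ℝ} {s : InnerState V} {v u : V} (hv : IsLowestActive G s v)
    (ha : G.Adj v u) (he : IsEligible φ s v u) : 0 < pushAmount G φ s v u := by
  have h1 := mass_le_of_lower hv he.1
  have h2 : (0 : ℝ) < G.degree u := by
    exact_mod_cast (G.degree_pos_iff_exists_adj u).2 ⟨v, ha.symm⟩
  unfold pushAmount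
  exact lt_min hv.1.2 (lt_min he.2 (by linarith))

theorem InnerState.move_flow_sum {s : InnerState V} {v u : V} (hne : v ≠ u) (ψ : ℝ) (a : V) :
    ∑ b, (s.move v u ψ).flow a b =
      ∑ b, s.flow a b + (if a = v then ψ else if a = u then -ψ else 0) := by
  have key : ∀ b, (s.move v u ψ).flow a b = s.flow a b +
      (if a = v then (if b = u then ψ else 0) else if a = u then (if b = v then -ψ else 0) else 0) := by
    intro b
    simp only [InnerState.move]
    by_cases h1 : a = v
    · subst h1
      by_cases h2 : b = u
      · simp [h2]
      · simp [h2, hne]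
    · by_cases h2 : a = u
      · subst h2
        by_cases h3 : b = v
        · simp [h3, h1]; ring
        · simp [h1, h3]
      · simp [h1, h2]
  rw [Finset.sum_congr rfl (fun b _ => key b), Finset.sum_add_distrib]
  congr 1
  by_cases h1 : a = v
  · simp [h1]
  · by_cases h2 : a = u
    · simp [h2, hne.symm]
    · simp [h1, h2]

/-- The only arc whose flow decreases is the reverse arc `(u, v)`. It points uphill, where `steep`
does not apply and `scanned` holds by its first alternative. -/
theorem InnerInv.move {adj : V → List V} {φ : ℝ} {m₀ : V → ℝ} {s : InnerState V}
    (hs : InnerInv G adj φ m₀ s) {v u : V} (hv : IsLowestActive G s v) (ha : G.Adj v u)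
    (he : IsEligible φ s v u) :
    InnerInv G adj φ m₀ (s.move v u (pushAmount G φ s v u)) := by
  have hne : v ≠ u := ha.ne
  have hpos := pushAmount_pos hv ha he
  have hle1 : pushAmount G φ s v u ≤ s.mass v - G.degree v := by
    rw [← excess_eq_of_isActive hv.1]; exact min_le_left _ _
  have hle2 : pushAmount G φ s v u ≤ min (s.label v : ℝ) (1 / φ) - s.flow v u :=
    (min_le_right _ _).trans (min_le_left _ _)
  have hle3 : pushAmount G φ s v u ≤ 2 * G.degree u - s.mass u :=
    (min_le_right _ _).trans (min_le_right _ _)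
  have hd : (0 : ℝ) ≤ G.degree v := Nat.cast_nonneg _
  generalize pushAmount G φ s v u = ψ at *
  have hflow : ∀ a b, ¬ (a = u ∧ b = v) → s.flow a b ≤ (s.move v u ψ).flow a b := by
    intro a b h
    simp only [InnerState.move]
    split_ifs with h1
    · obtain ⟨rfl, rfl⟩ := h1; linarith
    · exact le_rfl
  constructor
  · exact hs.limit_eq
  · intro a
    simp only [InnerState.move]
    split_ifs with h1 h2
    · linarith
    · linarith [hs.mass_nonneg u]
    · exact hs.mass_nonneg a
  · intro a
    simp only [InnerState.move]
    split_ifs with h1 h2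
    · subst h1; linarith [hs.mass_le a]
    · subst h2; linarith
    · exact hs.mass_le a
  · intro a b
    simp only [InnerState.move]
    by_cases h1 : a = v ∧ b = u
    · obtain ⟨rfl, rfl⟩ := h1
      simp [hne, hne.symm]
      linarith [hs.antisymm a b]
    · by_cases h2 : a = u ∧ b = v
      · obtain ⟨rfl, rfl⟩ := h2
        simp [hne, hne.symm]
        linarith [hs.antisymm a b]
      · have h1' : ¬ (b = u ∧ a = v) := fun h => h1 ⟨h.2, h.1⟩
        have h2' : ¬ (b = v ∧ a = u) := fun h => h2 ⟨h.2, h.1⟩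
        simp only [if_neg h1, if_neg h2, if_neg h1', if_neg h2']
        exact hs.antisymm a b
  · intro a b
    by_cases h1 : a = v ∧ b = u
    · obtain ⟨rfl, rfl⟩ := h1
      simp only [InnerState.move, and_self, if_true, adjInd, if_pos ha]
      linarith
    · refine le_trans ?_ (hs.flow_le a b)
      simp only [InnerState.move, if_neg h1]
      split_ifs with h2
      · obtain ⟨rfl, rfl⟩ := h2; linarith
      · exact le_rfl
  · intro a
    rw [InnerState.move_flow_sum hne]
    simp only [InnerState.move]
    split_ifs with h1 h2
    · subst h1; linarith [hs.mass_eq a]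
    · subst h2; linarith [hs.mass_eq a]
    · linarith [hs.mass_eq a]
  · intro a h
    have h' := hs.full a
    simp only [InnerState.move] at h ⊢
    split_ifs with h1 h2
    · subst h1; linarith
    · subst h2; linarith [h' h]
    · exact h' h
  · intro a p b hp hb
    by_cases h1 : a = u ∧ b = v
    · left
      obtain ⟨rfl, rfl⟩ := h1
      exact he.1.le
    · exact (hs.scanned a p b hp hb).imp id fun h => h.trans (hflow a b h1)
  · intro a b hab hl
    have h1 : ¬ (a = u ∧ b = v) := by
      rintro ⟨rfl, rfl⟩
      have : s.label b + 2 ≤ s.label a := hl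
      have := he.1
      omega
    exact (hs.steep a b hab hl).trans (hflow a b h1)
  · exact hs.label_le
  · exact hs.current_le

theorem InnerInv.advance {adj : V → List V} {φ : ℝ} {m₀ : V → ℝ} {s : InnerState V}
    (hs : InnerInv G adj φ m₀ s) {v : V} (hlen : (adj v).length = G.degree v)
    (hv : IsActive G s v)
    (he : ∀ u, (adj v)[s.current v]? = some u → ¬ IsEligible φ s v u)
    (hlt : s.current v + 1 < (adj v).length) :
    InnerInv G adj φ m₀ { s with current := Function.update s.current v (s.current v + 1) } := by
  constructor
  · exact hs.limit_eq
  · exact hs.mass_nonneg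
  · exact hs.mass_le
  · exact hs.antisymm
  · exact hs.flow_le
  · exact hs.mass_eq
  · intro a h
    by_cases hav : a = v
    · subst hav; exact (degree_lt_mass_of_isActive hv).le
    · exact hs.full a (by simpa [Function.update_of_ne hav] using h)
  · intro a p b hp hb
    by_cases hav : a = v
    · subst hav
      simp only [Function.update_self] at hp
      rcases Nat.lt_succ_iff_lt_or_eq.1 hp with h | h
      · exact hs.scanned a p b h hb
      · subst h
        have := he b hb
        simp only [IsEligible, residual, not_and_or, not_lt] at this
        exact this.imp id fun h => by linarith
    · exact hs.scanned a p b (by simpa [Function.update_of_ne hav] using hp) hb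
  · exact hs.steep
  · exact hs.label_le
  · intro a
    by_cases hav : a = v
    · subst hav; right; simp only [Function.update_self]; omega
    · simpa [Function.update_of_ne hav] using hs.current_le a

/-- Here `steep` is created: at this moment every downhill arc of `v` is saturated at the old label,
which is the new label minus 1. Raising the lower end of an arc only weakens the condition. -/
theorem InnerInv.relabel {adj : V → List V} {φ : ℝ} {m₀ : V → ℝ} {s : InnerState V}
    (hs : InnerInv G adj φ m₀ s) {v : V} (hadj : ∀ u, u ∈ adj v ↔ G.Adj v u)
    (hv : IsActive G s v)
    (he : ∀ u, (adj v)[s.current v]? = some u → ¬ IsEligible φ s v u)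
    (hge : (adj v).length ≤ s.current v + 1) :
    InnerInv G adj φ m₀ { s with
      label := Function.update s.label v (s.label v + 1)
      current := Function.update s.current v 0 } := by
  have hmono : ∀ a, s.label a ≤ Function.update s.label v (s.label v + 1) a := by
    intro a
    by_cases hav : a = v
    · subst hav; simp
    · simp [Function.update_of_ne hav]
  -- The list is exhausted: edges before the current one are covered by `scanned`, the current one
  -- by `he`.
  have hdone : ∀ u, G.Adj v u → s.label v ≤ s.label u ∨
      min (s.label v : ℝ) (1 / φ) ≤ s.flow v u := by
    intro u hu
    obtain ⟨p, hp, hpu⟩ := List.mem_iff_getElem.1 ((hadj u).2 hu)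
    have hpu' : (adj v)[p]? = some u := by rw [List.getElem?_eq_getElem hp, hpu]
    rcases lt_or_eq_of_le (show p ≤ s.current v by omega) with h | h
    · exact hs.scanned v p u h hpu'
    · subst h
      have := he u hpu'
      simp only [IsEligible, residual, not_and_or, not_lt] at this
      exact this.imp id fun h => by linarith
  constructor
  · exact hs.limit_eq
  · exact hs.mass_nonneg
  · exact hs.mass_le
  · exact hs.antisymm
  · intro a b
    refine (hs.flow_le a b).trans (mul_le_mul_of_nonneg_left ?_ (adjInd_nonneg G a b))
    exact min_le_min_right _ (by exact_mod_cast hmono a)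
  · exact hs.mass_eq
  · intro a h
    by_cases hav : a = v
    · subst hav; exact (degree_lt_mass_of_isActive hv).le
    · exact hs.full a (by simpa [Function.update_of_ne hav] using h)
  · intro a p b hp hb
    by_cases hav : a = v
    · subst hav; simp at hp
    · simp only [Function.update_of_ne hav] at hp ⊢
      exact (hs.scanned a p b hp hb).imp (fun h => h.trans (hmono b)) id
  · intro a b hab hl
    by_cases hav : a = v
    · subst hav
      have hba : b ≠ a := hab.ne'
      simp only [Function.update_self, Function.update_of_ne hba] at hl ⊢
      rcases hdone b hab with h | h
      · omega
      · push_cast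
        simpa using h
    · have := hmono b
      simp only [Function.update_of_ne hav] at hl ⊢
      exact hs.steep a b hab (by omega)
  · intro a
    by_cases hav : a = v
    · subst hav
      right
      simp only [Function.update_self]
      push_cast
      linarith [hv.1]
    · simpa [Function.update_of_ne hav] using hs.label_le a
  · intro a
    by_cases hav : a = v
    · subst hav; left; simp
    · simpa [Function.update_of_ne hav] using hs.current_le a

theorem IsAdjacencyList.length_eq {adj : V → List V} (hadj : IsAdjacencyList G adj) (v : V) :
    (adj v).length = G.degree v := by
  rw [← List.toFinset_card_of_nodup (hadj v).1, ← G.card_neighborFinset_eq_degree]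
  congr 1
  ext u
  simp [(hadj v).2 u]

theorem InnerInv.step {adj : V → List V} (hadj : IsAdjacencyList G adj) {φ : ℝ} {m₀ : V → ℝ}
    {s s' : InnerState V} (hs : InnerInv G adj φ m₀ s) (h : InnerStep G adj φ s s') :
    InnerInv G adj φ m₀ s' := by
  cases h with
  | push v u hv hu he =>
    exact hs.move hv (((hadj v).2 u).1 (List.mem_of_getElem? hu)) he
  | advance v hv he hlt => exact hs.advance (hadj.length_eq v) hv.1 he hlt
  | relabel v hv he hge => exact hs.relabel (hadj v).2 hv.1 he hge

/-! ### The potential that counts the steps -/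

/-- The masses and flows are integers, and the number `n` of steps done so far is paid for by the
labels and the current edges. -/
structure TimeInv (G : SimpleGraph V) [DecidableRel G.Adj] (n : ℕ) (s : InnerState V) :
    Prop where
  mass_int : ∀ v, ∃ z : ℤ, s.mass v = z
  flow_int : ∀ v u, ∃ z : ℤ, s.flow v u = z
  count : (n : ℝ) + ∑ v, excess G s v * s.label v ≤
    ∑ v, (2 * (G.degree v : ℝ) * s.label v + s.current v)

theorem TimeInv.init (φ : ℝ) (m₀ : V → ℝ) (h : ∀ v, ∃ z : ℤ, m₀ v = z) :
    TimeInv G 0 (.init φ m₀) where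
  mass_int := h
  flow_int _ _ := ⟨0, by simp [InnerState.init]⟩
  count := by simp [InnerState.init]

theorem exists_int_pushAmount {φ : ℝ} {s : InnerState V} (hφ : ∃ k : ℕ, 1 / φ = k)
    (hm : ∀ v, ∃ z : ℤ, s.mass v = z) (hf : ∀ v u, ∃ z : ℤ, s.flow v u = z) (v u : V) :
    ∃ z : ℤ, pushAmount G φ s v u = z := by
  obtain ⟨k, hk⟩ := hφ
  obtain ⟨a, ha⟩ := hm v
  obtain ⟨b, hb⟩ := hm u
  obtain ⟨c, hc⟩ := hf v u
  refine ⟨min (max (a - G.degree v) 0) (min (min (s.label v : ℤ) k - c) (2 * G.degree u - b)), ?_⟩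
  unfold pushAmount excess residual
  rw [ha, hb, hc, hk]
  push_cast
  rfl

/-- A push lowers `∑ ex · l` by at least 1, and an advance raises the right-hand side of `count` by
1. A relabel raises the right-hand side by `2 d(v) - current ≥ d(v) + 1`, which pays for the step
and for the increase `ex(v) ≤ d(v)` on the left. -/
theorem TimeInv.step {adj : V → List V} (hadj : IsAdjacencyList G adj) {φ : ℝ} {m₀ : V → ℝ}
    (hφ : ∃ k : ℕ, 1 / φ = k) {n : ℕ} {s s' : InnerState V} (hs : InnerInv G adj φ m₀ s)
    (ht : TimeInv G n s) (h : InnerStep G adj φ s s') : TimeInv G (n + 1) s' := by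
  cases h with
  | push v u hv hu he =>
    have ha : G.Adj v u := ((hadj v).2 u).1 (List.mem_of_getElem? hu)
    have hne : v ≠ u := ha.ne
    have hpos := pushAmount_pos hv ha he
    obtain ⟨z, hz⟩ := exists_int_pushAmount hφ ht.mass_int ht.flow_int v u (G := G)
    have hle1 : pushAmount G φ s v u ≤ s.mass v - G.degree v := by
      rw [← excess_eq_of_isActive hv.1]; exact min_le_left _ _
    generalize pushAmount G φ s v u = ψ at *
    -- Integrality enters here: a positive integral push moves at least one unit down at least one
    -- level.
    have hψ1 : 1 ≤ ψ := by
      rw [hz] at hpos ⊢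
      exact_mod_cast hpos
    constructor
    · intro a
      simp only [InnerState.move]
      obtain ⟨x, hx⟩ := ht.mass_int v
      obtain ⟨y, hy⟩ := ht.mass_int u
      split_ifs
      · exact ⟨x - z, by push_cast; rw [hx, hz]⟩
      · exact ⟨y + z, by push_cast; rw [hy, hz]⟩
      · exact ht.mass_int a
    · intro a b
      simp only [InnerState.move]
      obtain ⟨x, hx⟩ := ht.flow_int v u
      obtain ⟨y, hy⟩ := ht.flow_int u v
      split_ifs
      · exact ⟨x + z, by push_cast; rw [hx, hz]⟩
      · exact ⟨y - z, by push_cast; rw [hy, hz]⟩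
      · exact ht.flow_int a b
    · have hc := ht.count
      have hlab : (s.label u : ℝ) + 1 ≤ s.label v := by exact_mod_cast he.1
      have hev := excess_eq_of_isActive hv.1
      have hum := mass_le_of_lower hv he.1
      have key : ∀ a, excess G (s.move v u ψ) a * (s.label a : ℝ) ≤ excess G s a * s.label a +
          ((if a = v then -ψ * s.label v else 0) + (if a = u then ψ * s.label u else 0)) := by
        intro a
        by_cases h1 : a = v
        · subst h1
          have : excess G (s.move a u ψ) a = s.mass a - ψ - G.degree a := by
            simp only [excess, InnerState.move, if_true]
            exact max_eq_left (by linarith)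
          rw [this, hev]
          simp only [if_true, if_neg hne]
          linarith
        · by_cases h2 : a = u
          · subst h2
            have h0 : excess G s a = 0 := max_eq_right (by linarith)
            have : excess G (s.move v a ψ) a ≤ ψ := by
              simp only [excess, InnerState.move, if_true, if_neg h1]
              exact max_le (by linarith) (by linarith)
            rw [h0]
            simp only [if_true, if_neg h1]
            have := mul_le_mul_of_nonneg_right this (Nat.cast_nonneg (α := ℝ) (s.label a))
            linarith
          · simp [excess, InnerState.move, h1, h2]
      have hsum := Finset.sum_le_sum fun a (_ : a ∈ Finset.univ) => key a
      rw [Finset.sum_add_distrib, Finset.sum_add_distrib] at hsum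
      simp only [Finset.sum_ite_eq', Finset.mem_univ, if_true] at hsum
      have h3 : ψ * 1 ≤ ψ * ((s.label v : ℝ) - s.label u) :=
        mul_le_mul_of_nonneg_left (by linarith) hpos.le
      push_cast
      have hl : (s.move v u ψ).label = s.label := rfl
      have hcur : (s.move v u ψ).current = s.current := rfl
      rw [hl, hcur]
      linarith
  | advance v hv he hlt =>
    refine ⟨ht.mass_int, ht.flow_int, ?_⟩
    have hc := ht.count
    have key : ∀ a, (2 * (G.degree a : ℝ) * s.label a +
        (Function.update s.current v (s.current v + 1) a : ℕ)) =
        (2 * (G.degree a : ℝ) * s.label a + s.current a) + if a = v then 1 else 0 := by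
      intro a
      by_cases h1 : a = v
      · subst h1; simp; ring
      · simp [h1]
    have hsum : ∑ a, (2 * (G.degree a : ℝ) * s.label a +
        (Function.update s.current v (s.current v + 1) a : ℕ)) =
        ∑ a, (2 * (G.degree a : ℝ) * s.label a + s.current a) + 1 := by
      rw [Finset.sum_congr rfl fun a _ => key a, Finset.sum_add_distrib]
      simp
    have hex : ∀ a, excess G { s with
        current := Function.update s.current v (s.current v + 1) } a = excess G s a := fun a => rfl
    simp only [hex]
    rw [hsum]
    push_cast
    linarith
  | relabel v hv he hge =>
    refine ⟨ht.mass_int, ht.flow_int, ?_⟩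
    have hc := ht.count
    have hdm := degree_lt_mass_of_isActive hv.1
    have hev := excess_eq_of_isActive hv.1
    have hm2 := hs.mass_le v
    have hdpos : (1 : ℝ) ≤ G.degree v := by
      have : (0 : ℝ) < G.degree v := by linarith
      exact_mod_cast this
    have hcur : (s.current v : ℝ) + 1 ≤ G.degree v := by
      rcases hs.current_le v with h | h
      · rw [h]; simpa using hdpos
      · exact_mod_cast h
    have key : ∀ a, (2 * (G.degree a : ℝ) * (Function.update s.label v (s.label v + 1) a : ℕ) +
        (Function.update s.current v 0 a : ℕ)) =
        (2 * (G.degree a : ℝ) * s.label a + s.current a) +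
          if a = v then 2 * (G.degree v : ℝ) - s.current v else 0 := by
      intro a
      by_cases h1 : a = v
      · subst h1; simp; ring
      · simp [h1]
    have key2 : ∀ a, excess G s a * (Function.update s.label v (s.label v + 1) a : ℕ) =
        excess G s a * s.label a + if a = v then excess G s v else 0 := by
      intro a
      by_cases h1 : a = v
      · subst h1; simp; ring
      · simp [h1]
    have hsum : ∑ a, (2 * (G.degree a : ℝ) *
        (Function.update s.label v (s.label v + 1) a : ℕ) +
        (Function.update s.current v 0 a : ℕ)) =
        ∑ a, (2 * (G.degree a : ℝ) * s.label a + s.current a) +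
          (2 * (G.degree v : ℝ) - s.current v) := by
      rw [Finset.sum_congr rfl fun a _ => key a, Finset.sum_add_distrib]
      simp
    have hsum2 : ∑ a, excess G s a * (Function.update s.label v (s.label v + 1) a : ℕ) =
        ∑ a, excess G s a * s.label a + excess G s v := by
      rw [Finset.sum_congr rfl fun a _ => key2 a, Finset.sum_add_distrib]
      simp
    have hex : ∀ a, excess G { s with
        label := Function.update s.label v (s.label v + 1)
        current := Function.update s.current v 0 } a = excess G s a := fun a => rfl
    simp only [hex]
    rw [hsum, hsum2]
    push_cast
    linarith

end Inner

/-! ### Volumes, cuts and conservation of mass as sums over arcs -/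

section Sums

variable {V : Type*} [Fintype V] [DecidableEq V] (G : SimpleGraph V) [DecidableRel G.Adj]

theorem cut_eq_sum (S T : Finset V) :
    (cut G S T : ℝ) = ∑ v ∈ S, ∑ u ∈ T, adjInd G v u := by
  unfold cut adjInd SimpleGraph.interedges Rel.interedges
  rw [Finset.card_filter, Finset.sum_product]
  push_cast
  rfl

theorem degree_eq_sum (v : V) : (G.degree v : ℝ) = ∑ u, adjInd G v u := by
  unfold adjInd
  rw [Finset.sum_boole, ← G.card_neighborFinset_eq_degree]
  congr 2
  ext u
  simp

theorem vol_eq_sum (S : Finset V) : (vol G S : ℝ) = ∑ v ∈ S, (G.degree v : ℝ) := by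
  simp [vol]

theorem volIn_eq_sum (B T : Finset V) :
    (volIn G B T : ℝ) = ∑ v ∈ T, ∑ u ∈ B, adjInd G v u := by
  unfold volIn adjInd
  push_cast
  refine Finset.sum_congr rfl fun v _ => ?_
  rw [Finset.sum_boole]
  congr 2
  ext u
  simp [and_comm]

theorem vol_eq_volIn_add_cut (B T : Finset V) :
    (vol G T : ℝ) = volIn G B T + cut G T Bᶜ := by
  rw [vol_eq_sum, volIn_eq_sum, cut_eq_sum, ← Finset.sum_add_distrib]
  refine Finset.sum_congr rfl fun v _ => ?_
  rw [degree_eq_sum, Finset.sum_add_sum_compl]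

theorem volIn_le_vol (B T : Finset V) : (volIn G B T : ℝ) ≤ vol G T := by
  rw [vol_eq_volIn_add_cut G B T]
  linarith [Nat.cast_nonneg (α := ℝ) (cut G T Bᶜ)]

theorem cut_comm (S T : Finset V) : (cut G S T : ℝ) = cut G T S := by
  rw [cut_eq_sum, cut_eq_sum, Finset.sum_comm]
  simp only [adjInd_comm]

theorem volIn_sdiff {B T : Finset V} (h : T ⊆ B) :
    (volIn G B (B \ T) : ℝ) = volIn G B B - volIn G B T := by
  rw [volIn_eq_sum, volIn_eq_sum, volIn_eq_sum, ← Finset.sum_sdiff h]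
  ring

theorem volIn_mono {B S T : Finset V} (h : S ⊆ T) : (volIn G B S : ℝ) ≤ volIn G B T := by
  unfold volIn
  exact_mod_cast Finset.sum_le_sum_of_subset h

theorem cut_le_volIn {B S T : Finset V} (h : T ⊆ B) : (cut G S T : ℝ) ≤ volIn G B S := by
  rw [cut_eq_sum, volIn_eq_sum]
  exact Finset.sum_le_sum fun v _ => Finset.sum_le_sum_of_subset_of_nonneg h
    fun u _ _ => adjInd_nonneg G v u

/-- An antisymmetric function has total `0` on the arcs inside a set. -/
theorem sum_sum_antisymm {f : V → V → ℝ} (hf : ∀ v u, f v u = - f u v) (A : Finset V) :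
    ∑ v ∈ A, ∑ u ∈ A, f v u = 0 := by
  have h : ∑ v ∈ A, ∑ u ∈ A, f v u = - ∑ v ∈ A, ∑ u ∈ A, f v u := by
    conv_lhs => rw [Finset.sum_comm]
    simp only [← Finset.sum_neg_distrib]
    exact Finset.sum_congr rfl fun v _ => Finset.sum_congr rfl fun u _ => hf u v
  linarith

variable {G}

variable {adj : V → List V} {φ : ℝ} {m₀ : V → ℝ} {s : InnerState V}

/-- The mass lost by `A` is the net flow out of `A`. -/
theorem InnerInv.mass_balance (hs : InnerInv G adj φ m₀ s) (A : Finset V) :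
    ∑ v ∈ A, s.mass v = ∑ v ∈ A, m₀ v - ∑ v ∈ A, ∑ u ∈ Aᶜ, s.flow v u := by
  have h := sum_sum_antisymm hs.antisymm A
  have : ∑ v ∈ A, ∑ u, s.flow v u =
      ∑ v ∈ A, ∑ u ∈ A, s.flow v u + ∑ v ∈ A, ∑ u ∈ Aᶜ, s.flow v u := by
    rw [← Finset.sum_add_distrib]
    exact Finset.sum_congr rfl fun v _ => (Finset.sum_add_sum_compl A _).symm
  rw [Finset.sum_congr rfl fun v _ => hs.mass_eq v, Finset.sum_sub_distrib, this, h]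
  ring

theorem InnerInv.mass_total (hs : InnerInv G adj φ m₀ s) : ∑ v, s.mass v = ∑ v, m₀ v := by
  have := hs.mass_balance Finset.univ
  simpa using this

/-- Touched vertices are full, so their volume is paid for by the mass. This makes the algorithm
local. -/
theorem InnerInv.vol_le_total (hs : InnerInv G adj φ m₀ s) {A : Finset V}
    (hA : ∀ v ∈ A, 0 < s.label v ∨ 0 < s.current v) : (vol G A : ℝ) ≤ ∑ v, m₀ v := by
  rw [← hs.mass_total, vol_eq_sum]
  exact (Finset.sum_le_sum fun v hv => hs.full v (hA v hv)).trans
    (Finset.sum_le_sum_of_subset_of_nonneg (Finset.subset_univ _) fun v _ _ => hs.mass_nonneg v)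

theorem InnerInv.le_flow (hs : InnerInv G adj φ m₀ s) (v u : V) :
    - (adjInd G v u * min (s.label u : ℝ) (1 / φ)) ≤ s.flow v u := by
  rw [hs.antisymm, adjInd_comm]
  exact neg_le_neg (hs.flow_le u v)

theorem InnerInv.flow_le_div (hs : InnerInv G adj φ m₀ s) (v u : V) :
    s.flow v u ≤ adjInd G v u * (1 / φ) :=
  (hs.flow_le v u).trans (mul_le_mul_of_nonneg_left (min_le_right _ _) (adjInd_nonneg G v u))

theorem InnerInv.neg_div_le_flow (hs : InnerInv G adj φ m₀ s) (v u : V) :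
    - (adjInd G v u * (1 / φ)) ≤ s.flow v u :=
  le_trans (neg_le_neg (mul_le_mul_of_nonneg_left (min_le_right _ _) (adjInd_nonneg G v u)))
    (hs.le_flow v u)

/-- The number of iterations of the while loop. -/
theorem TimeInv.count_le (hs : InnerInv G adj φ m₀ s) {n : ℕ} (ht : TimeInv G n s)
    (hL : 0 ≤ s.limit) : (n : ℝ) ≤ (2 * s.limit + 3) * ∑ v, m₀ v := by
  have h1 : 0 ≤ ∑ v, excess G s v * s.label v :=
    Finset.sum_nonneg fun v _ => mul_nonneg (le_max_right _ _) (Nat.cast_nonneg _)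
  have h2 : ∀ v, 2 * (G.degree v : ℝ) * s.label v + s.current v ≤
      (2 * s.limit + 3) * s.mass v := by
    intro v
    have hm := hs.mass_nonneg v
    have hd : (0 : ℝ) ≤ G.degree v := Nat.cast_nonneg _
    by_cases h : 0 < s.label v ∨ 0 < s.current v
    · have hf := hs.full v h
      have hl : (s.label v : ℝ) ≤ s.limit + 1 := by
        rcases hs.label_le v with h | h
        · rw [h]; push_cast; linarith
        · exact h.le
      have hc : (s.current v : ℝ) ≤ G.degree v := by
        rcases hs.current_le v with h | h
        · rw [h]; simp
        · exact_mod_cast (by omega : s.current v ≤ G.degree v)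
      calc 2 * (G.degree v : ℝ) * s.label v + s.current v
          ≤ 2 * (G.degree v : ℝ) * (s.limit + 1) + G.degree v := by gcongr
        _ = (2 * s.limit + 3) * G.degree v := by ring
        _ ≤ _ := by gcongr
    · push Not at h
      have a1 : s.label v = 0 := by omega
      have a2 : s.current v = 0 := by omega
      rw [a1, a2]
      simp only [Nat.cast_zero, mul_zero, add_zero]
      positivity
  have h3 := Finset.sum_le_sum fun v (_ : v ∈ Finset.univ) => h2 v
  rw [← Finset.mul_sum, hs.mass_total] at h3
  linarith [ht.count]

theorem TimeInv.overhead_le (hs : InnerInv G adj φ m₀ s) {n : ℕ} (ht : TimeInv G n s) :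
    (overhead G s : ℝ) ≤ 1 + 2 * ∑ v, m₀ v := by
  classical
  unfold overhead
  push_cast
  have h1 : ((Finset.univ.filter (fun v => 0 < s.mass v)).card : ℝ) ≤ ∑ v, m₀ v := by
    rw [← hs.mass_total, Finset.card_eq_sum_ones]
    push_cast
    refine (Finset.sum_le_sum fun v hv => ?_).trans
      (Finset.sum_le_sum_of_subset_of_nonneg (Finset.subset_univ _) fun v _ _ => hs.mass_nonneg v)
    obtain ⟨z, hz⟩ := ht.mass_int v
    have hpos := (Finset.mem_filter.1 hv).2
    rw [hz] at hpos ⊢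
    exact_mod_cast hpos
  have h2 := hs.vol_le_total (A := Finset.univ.filter (fun v => 0 < s.label v))
    fun v hv => Or.inl (Finset.mem_filter.1 hv).2
  rw [vol_eq_sum] at h2
  linarith

end Sums

/-- Multiply `exp (-x/2) ≥ 1 - x/2` by `exp (x/2)`, and use `(1 + x)(1 - x/2) ≥ 1` on `[0, 1]`. This
turns growth by factors into exponential growth. -/
theorem exp_half_le_one_add {x : ℝ} (h0 : 0 ≤ x) (h1 : x ≤ 1) : Real.exp (x / 2) ≤ 1 + x := by
  have h2 := Real.add_one_le_exp (-(x / 2))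
  have h3 : Real.exp (x / 2) * Real.exp (-(x / 2)) = 1 := by rw [← Real.exp_add]; simp
  have h4 := Real.exp_pos (x / 2)
  have h5 : Real.exp (x / 2) * (1 - x / 2) ≤ 1 := by
    rw [← h3]; exact mul_le_mul_of_nonneg_left (by linarith) h4.le
  nlinarith [mul_nonneg h0 (sub_nonneg.2 h1)]

theorem exp_le_one_add_pow {x : ℝ} (h0 : 0 ≤ x) (h1 : x ≤ 1) (k : ℕ) :
    Real.exp (k * (x / 2)) ≤ (1 + x) ^ k := by
  rw [Real.exp_nat_mul]
  exact pow_le_pow_left₀ (Real.exp_pos _).le (exp_half_le_one_add h0 h1) k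

/-! ### Level sets of the labels and the saturation of `B` -/

section Saturation

variable {V : Type*} [Fintype V] [DecidableEq V] (G : SimpleGraph V) [DecidableRel G.Adj]

/-- The vertices of `B` of label at least `i`. -/
def levelSet (l : V → ℕ) (B : Finset V) (i : ℕ) : Finset V :=
  B.filter (fun v => i ≤ l v)

/-- The indicator of the arcs along which the label drops by exactly `1`. -/
noncomputable def shortInd (l : V → ℕ) (v u : V) : ℝ :=
  if l v = l u + 1 then adjInd G v u else 0

/-- The number of edges leaving a level set inside `B` along which the label drops by `1`. -/
noncomputable def shortCut (l : V → ℕ) (B : Finset V) (i : ℕ) : ℝ :=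
  ∑ v ∈ levelSet l B i, ∑ u ∈ B \ levelSet l B i, shortInd G l v u

theorem mem_levelSet {l : V → ℕ} {B : Finset V} {i : ℕ} {v : V} :
    v ∈ levelSet l B i ↔ v ∈ B ∧ i ≤ l v := by
  simp [levelSet]

theorem mem_sdiff_levelSet {l : V → ℕ} {B : Finset V} {i : ℕ} {v : V} :
    v ∈ B \ levelSet l B i ↔ v ∈ B ∧ l v < i := by
  simp only [Finset.mem_sdiff, mem_levelSet]
  constructor
  · rintro ⟨h1, h2⟩; exact ⟨h1, by by_contra h; exact h2 ⟨h1, by omega⟩⟩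
  · rintro ⟨h1, h2⟩; exact ⟨h1, fun h => by omega⟩

theorem levelSet_subset (l : V → ℕ) (B : Finset V) (i : ℕ) : levelSet l B i ⊆ B :=
  Finset.filter_subset _ _

theorem levelSet_anti (l : V → ℕ) (B : Finset V) {i j : ℕ} (h : i ≤ j) :
    levelSet l B j ⊆ levelSet l B i := fun v hv => by
  rw [mem_levelSet] at hv ⊢
  exact ⟨hv.1, h.trans hv.2⟩

theorem shortInd_le (l : V → ℕ) (v u : V) : shortInd G l v u ≤ adjInd G v u := by
  unfold shortInd
  split_ifs
  · exact le_rfl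
  · exact adjInd_nonneg G v u

/-- Each short edge out of `L_i` ends in `L_{i-1} \ L_i`. -/
theorem volIn_levelSet_add_shortCut_le (l : V → ℕ) (B : Finset V) (i : ℕ) :
    (volIn G B (levelSet l B (i + 1)) : ℝ) + shortCut G l B (i + 1) ≤
      volIn G B (levelSet l B i) := by
  rw [volIn_eq_sum, volIn_eq_sum, ← Finset.sum_sdiff (levelSet_anti l B (Nat.le_succ i)), add_comm]
  refine add_le_add_left ?_ _
  unfold shortCut
  rw [Finset.sum_comm]
  have hsub : levelSet l B i \ levelSet l B (i + 1) ⊆ B \ levelSet l B (i + 1) :=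
    Finset.sdiff_subset_sdiff (levelSet_subset l B i) le_rfl
  rw [← Finset.sum_subset hsub]
  · refine Finset.sum_le_sum fun u _ => ?_
    refine (Finset.sum_le_sum fun v _ => ?_).trans
      (Finset.sum_le_sum_of_subset_of_nonneg (levelSet_subset l B (i + 1))
        fun v _ _ => adjInd_nonneg G u v)
    rw [adjInd_comm]
    exact shortInd_le G l v u
  · intro u hu hu'
    refine Finset.sum_eq_zero fun v hv => ?_
    rw [mem_sdiff_levelSet] at hu
    rw [mem_levelSet] at hv
    have : ¬ (l v = l u + 1) := by
      intro h
      apply hu'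
      rw [Finset.mem_sdiff, mem_levelSet, mem_levelSet]
      exact ⟨⟨hu.1, by omega⟩, fun h' => by omega⟩
    simp [shortInd, this]

/-- Each short edge out of `L_i` starts in `L_i \ L_{i+1}`. -/
theorem volIn_sdiff_levelSet_add_shortCut_le (l : V → ℕ) (B : Finset V) (i : ℕ) :
    (volIn G B (B \ levelSet l B i) : ℝ) + shortCut G l B i ≤
      volIn G B (B \ levelSet l B (i + 1)) := by
  have hsub0 : B \ levelSet l B i ⊆ B \ levelSet l B (i + 1) :=
    Finset.sdiff_subset_sdiff le_rfl (levelSet_anti l B (Nat.le_succ i))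
  rw [volIn_eq_sum, volIn_eq_sum, ← Finset.sum_sdiff hsub0, add_comm]
  refine add_le_add_left ?_ _
  unfold shortCut
  have hsub : (B \ levelSet l B (i + 1)) \ (B \ levelSet l B i) ⊆ levelSet l B i := by
    intro v hv
    rw [Finset.mem_sdiff, mem_sdiff_levelSet, mem_sdiff_levelSet] at hv
    rw [mem_levelSet]
    exact ⟨hv.1.1, by by_contra h; exact hv.2 ⟨hv.1.1, by omega⟩⟩
  rw [← Finset.sum_subset hsub]
  · refine Finset.sum_le_sum fun v _ => ?_
    exact (Finset.sum_le_sum fun u _ => shortInd_le G l v u).trans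
      (Finset.sum_le_sum_of_subset_of_nonneg Finset.sdiff_subset
        fun u _ _ => adjInd_nonneg G v u)
  · intro v hv hv'
    refine Finset.sum_eq_zero fun u hu => ?_
    rw [mem_sdiff_levelSet] at hu
    rw [mem_levelSet] at hv
    have : ¬ (l v = l u + 1) := by
      intro h
      apply hv'
      rw [Finset.mem_sdiff, mem_sdiff_levelSet, mem_sdiff_levelSet]
      exact ⟨⟨hv.1, by omega⟩, fun h' => by omega⟩
    simp [shortInd, this]

variable {G}

variable {adj : V → List V} {φ : ℝ} {m₀ : V → ℝ} {s : InnerState V}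

/-- The flow along an arc that crosses level `i` downwards. -/
theorem InnerInv.crossing_flow (hs : InnerInv G adj φ m₀ s) {i : ℕ} {v u : V} (hv : i ≤ s.label v)
    (hu : s.label u < i) :
    min ((i : ℝ) - 1) (1 / φ) * (adjInd G v u - 2 * shortInd G s.label v u) ≤ s.flow v u := by
  by_cases ha : G.Adj v u
  · have h1 : adjInd G v u = 1 := by simp [adjInd, ha]
    by_cases hshort : s.label v = s.label u + 1
    -- The lower end of a short crossing edge has label exactly `i - 1`, so its backward flow is at
    -- most what a steep edge carries forward. Going from `+1` to `-1` explains the factor 2.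
    · have h2 : shortInd G s.label v u = 1 := by simp [shortInd, hshort, h1]
      have h3 := hs.le_flow v u
      have hi : s.label u + 1 = i := by omega
      have h4 : (s.label u : ℝ) = (i : ℝ) - 1 := by rw [← hi]; push_cast; ring
      rw [h1, h4] at h3
      rw [h1, h2]
      linarith
    · have h2 : shortInd G s.label v u = 0 := by simp [shortInd, hshort]
      have h3 := hs.steep v u ha (by omega)
      rw [h1, h2]
      refine le_trans ?_ h3
      rw [mul_zero, sub_zero, mul_one]
      exact min_le_min_right _ (by linarith [(by exact_mod_cast hv : (i : ℝ) ≤ s.label v)])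
  · have h1 : adjInd G v u = 0 := by simp [adjInd, ha]
    have h2 : shortInd G s.label v u = 0 := by simp [shortInd, h1]
    have h3 := hs.le_flow v u
    rw [h1] at h3
    rw [h1, h2]
    simpa using h3

theorem sum_compl_eq {B L : Finset V} (h : L ⊆ B) (f : V → ℝ) :
    ∑ u ∈ Lᶜ, f u = ∑ u ∈ B \ L, f u + ∑ u ∈ Bᶜ, f u := by
  rw [← Finset.sum_union]
  · congr 1
    ext u
    simp only [Finset.mem_compl, Finset.mem_union, Finset.mem_sdiff]
    have := @h u
    tauto
  · rw [Finset.disjoint_left]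
    intro u hu
    simp only [Finset.mem_compl, Finset.mem_sdiff] at hu ⊢
    tauto

/-- The level set starts with at most twice its volume and is still full, so at most its volume has
flowed out. Above level `1/φ` each steep edge carries `1/φ` outwards, while edges to the outside of
`B` bring in at most `1/φ` each. -/
theorem InnerInv.cut_levelSet_le (hs : InnerInv G adj φ m₀ s) (hφ : 0 < φ)
    (hm2 : ∀ v, m₀ v ≤ 2 * G.degree v) {B : Finset V} {i : ℕ}
    (hi0 : 1 ≤ i) (hi : 1 / φ ≤ (i : ℝ) - 1) :
    (cut G (levelSet s.label B i) (B \ levelSet s.label B i) : ℝ) ≤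
      φ * vol G (levelSet s.label B i) + 2 * shortCut G s.label B i +
        cut G (levelSet s.label B i) Bᶜ := by
  set L := levelSet s.label B i with hL
  have hbal := hs.mass_balance L
  have h1 : (vol G L : ℝ) ≤ ∑ v ∈ L, s.mass v := by
    rw [vol_eq_sum]
    exact Finset.sum_le_sum fun v hv => hs.full v (Or.inl (by
      have := (mem_levelSet.1 hv).2; omega))
  have h2 : ∑ v ∈ L, m₀ v ≤ 2 * (vol G L : ℝ) := by
    rw [vol_eq_sum, Finset.mul_sum]
    exact Finset.sum_le_sum fun v _ => hm2 v
  have h3 : (1 / φ) * (cut G L (B \ L) - 2 * shortCut G s.label B i - cut G L Bᶜ) ≤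
      ∑ v ∈ L, ∑ u ∈ Lᶜ, s.flow v u := by
    have : (1 / φ) * ((cut G L (B \ L) : ℝ) - 2 * shortCut G s.label B i - cut G L Bᶜ) =
        ∑ v ∈ L, (∑ u ∈ B \ L, (1 / φ) * (adjInd G v u - 2 * shortInd G s.label v u) +
          ∑ u ∈ Bᶜ, -(adjInd G v u * (1 / φ))) := by
      rw [cut_eq_sum, cut_eq_sum, shortCut, ← hL]
      simp only [Finset.sum_add_distrib, Finset.sum_neg_distrib, ← Finset.mul_sum,
        ← Finset.sum_mul, Finset.sum_sub_distrib]
      ring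
    rw [this]
    refine Finset.sum_le_sum fun v hv => ?_
    rw [sum_compl_eq (levelSet_subset _ _ _)]
    refine add_le_add (Finset.sum_le_sum fun u hu => ?_)
      (Finset.sum_le_sum fun u _ => hs.neg_div_le_flow v u)
    have := hs.crossing_flow (mem_levelSet.1 hv).2 (mem_sdiff_levelSet.1 hu).2
    rwa [min_eq_right hi] at this
  have h4 : (1 / φ) * ((cut G L (B \ L) : ℝ) - 2 * shortCut G s.label B i - cut G L Bᶜ) ≤
      vol G L := by linarith
  rw [one_div, inv_mul_le_iff₀ hφ] at h4
  linarith

/-- The same flow seen from below: the complement in `B` can hold at most twice its volume, apart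
from what leaks out of `B`. -/
theorem InnerInv.cut_sdiff_levelSet_le (hs : InnerInv G adj φ m₀ s) (hφ : 0 < φ)
    (hm0 : ∀ v, 0 ≤ m₀ v) {B : Finset V} {i : ℕ} (hi : 1 / φ ≤ (i : ℝ) - 1) :
    (cut G (levelSet s.label B i) (B \ levelSet s.label B i) : ℝ) ≤
      2 * φ * vol G (B \ levelSet s.label B i) + 2 * shortCut G s.label B i +
        cut G (B \ levelSet s.label B i) Bᶜ := by
  set L := levelSet s.label B i with hL
  have hbal := hs.mass_balance (B \ L)
  have h1 : ∑ v ∈ B \ L, s.mass v ≤ 2 * (vol G (B \ L) : ℝ) := by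
    rw [vol_eq_sum, Finset.mul_sum]
    exact Finset.sum_le_sum fun v _ => hs.mass_le v
  have h2 : 0 ≤ ∑ v ∈ B \ L, m₀ v := Finset.sum_nonneg fun v _ => hm0 v
  have h3 : ∑ u ∈ B \ L, ∑ v ∈ (B \ L)ᶜ, s.flow u v ≤
      -((1 / φ) * ((cut G L (B \ L) : ℝ) - 2 * shortCut G s.label B i - cut G (B \ L) Bᶜ)) := by
    have : -((1 / φ) * ((cut G L (B \ L) : ℝ) - 2 * shortCut G s.label B i - cut G (B \ L) Bᶜ)) =
        ∑ u ∈ B \ L, (∑ v ∈ L, -((1 / φ) * (adjInd G v u - 2 * shortInd G s.label v u)) +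
          ∑ v ∈ Bᶜ, adjInd G u v * (1 / φ)) := by
      rw [cut_eq_sum, cut_eq_sum, shortCut, ← hL]
      simp only [Finset.sum_add_distrib, Finset.sum_neg_distrib, ← Finset.mul_sum,
        ← Finset.sum_mul, Finset.sum_sub_distrib]
      rw [Finset.sum_comm, Finset.sum_comm (s := L) (f := fun v u => shortInd G s.label v u)]
      ring
    rw [this]
    refine Finset.sum_le_sum fun u hu => ?_
    rw [sum_compl_eq Finset.sdiff_subset, Finset.sdiff_sdiff_eq_self (levelSet_subset _ _ _)]
    refine add_le_add (Finset.sum_le_sum fun v hv => ?_)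
      (Finset.sum_le_sum fun v _ => hs.flow_le_div u v)
    have := hs.crossing_flow (mem_levelSet.1 hv).2 (mem_sdiff_levelSet.1 hu).2
    rw [min_eq_right hi] at this
    rw [hs.antisymm]
    exact neg_le_neg this
  have h4 : (1 / φ) * ((cut G L (B \ L) : ℝ) - 2 * shortCut G s.label B i - cut G (B \ L) Bᶜ) ≤
      2 * vol G (B \ L) := by linarith
  rw [one_div, inv_mul_le_iff₀ hφ] at h4
  linarith

/-- If some vertex of `B` reaches the label limit, then every vertex of `B` has positive label. -/
theorem InnerInv.label_pos (hs : InnerInv G adj φ m₀ s) (hφ : 0 < φ) (hm0 : ∀ v, 0 ≤ m₀ v)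
    (hm2 : ∀ v, m₀ v ≤ 2 * G.degree v) {B : Finset V} {ψ : ℝ} (hψ1 : ψ ≤ 1)
    (hφψ : φ ≤ 1 / 100 * ψ) (hM : 2 ≤ ∑ v, m₀ v)
    (hexp : ∀ T, T ⊆ B → 2 * (volIn G B T : ℝ) ≤ volIn G B B →
      ψ * volIn G B T ≤ cut G T (B \ T))
    (hsm : ∀ T, T ⊆ B → 2 * (volIn G B T : ℝ) ≤ volIn G B B →
      10 * (cut G T Bᶜ : ℝ) ≤ cut G T (B \ T))
    (hpos : ∀ v ∈ B, 1 ≤ volIn G B {v})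
    (htop : ∃ v ∈ B, s.limit ≤ s.label v) : ∀ v ∈ B, 0 < s.label v := by
  set M := ∑ v, m₀ v with hMdef
  have hlim : s.limit = 3 * Real.log M / φ := hs.limit_eq
  have hψ0 : 0 < ψ := by linarith
  have hlogM : 0.69 ≤ Real.log M :=
    le_trans (by linarith [Real.log_two_gt_d9]) (Real.log_le_log (by norm_num) hM)
  have hMpos : 0 < M := by linarith
  have hφ1 : φ ≤ 1 / 100 := by linarith
  obtain ⟨v, hvB, hv⟩ := htop
  set N := s.label v with hN
  -- The levels split into two growth phases, from `N` down to `p` and from `q` up to `p`, each of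
  -- length at least `0.4 log M / φ`. Levels from `q` on lie above `1/φ`, where the capacity is
  -- constant.
  set p := ⌈(5 / 2) * Real.log M / φ⌉₊ with hp
  set q := ⌈1 / φ⌉₊ + 1 with hq
  have hplo : (5 / 2) * Real.log M / φ ≤ p := Nat.le_ceil _
  have hphi : (p : ℝ) < (5 / 2) * Real.log M / φ + 1 := Nat.ceil_lt_add_one (by positivity)
  have hqlo : 1 / φ ≤ (q : ℝ) - 1 := by
    rw [hq]; push_cast; linarith [Nat.le_ceil (1 / φ)]
  have hqhi : (q : ℝ) < 1 / φ + 2 := by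
    rw [hq]; push_cast; linarith [Nat.ceil_lt_add_one (show 0 ≤ 1 / φ by positivity)]
  have hNlo : 3 * Real.log M / φ ≤ N := by rw [← hlim]; exact hv
  have hNp : 0.4 * Real.log M ≤ ((N : ℝ) - p) * φ := by
    have h1 : 3 * Real.log M ≤ N * φ := by rwa [div_le_iff₀ hφ] at hNlo
    have h2 : (p : ℝ) * φ ≤ (5 / 2) * Real.log M + φ := by
      calc (p : ℝ) * φ ≤ ((5 / 2) * Real.log M / φ + 1) * φ := by gcongr
        _ = _ := by field_simp
    linarith
  have hpq : 0.4 * Real.log M ≤ ((p : ℝ) - q) * φ := by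
    have h1 : (5 / 2) * Real.log M ≤ p * φ := by rwa [div_le_iff₀ hφ] at hplo
    have h2 : (q : ℝ) * φ ≤ 1 + 2 * φ := by
      calc (q : ℝ) * φ ≤ (1 / φ + 2) * φ := by gcongr
        _ = _ := by field_simp
    linarith
  have hpos_of : ∀ x : ℝ, 0.4 * Real.log M ≤ x * φ → 0 < x := by
    intro x hx
    by_contra h
    have : x * φ ≤ 0 := mul_nonpos_of_nonpos_of_nonneg (not_lt.1 h) hφ.le
    linarith
  have hpN' : p ≤ N := by
    have := hpos_of _ hNp
    exact_mod_cast (by linarith : (p : ℝ) ≤ N)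
  have hqp' : q ≤ p := by
    have := hpos_of _ hpq
    exact_mod_cast (by linarith : (q : ℝ) ≤ p)
  have hx0 : 0 ≤ ψ / 4 := by linarith
  have hx1 : ψ / 4 ≤ 1 := by linarith
  -- Since `ψ ≥ 100 φ`, the exponent `k ψ / 8` is at least `5 log M`.
  have hbig : ∀ k : ℕ, 0.4 * Real.log M ≤ (k : ℝ) * φ → M < (1 + ψ / 4) ^ k := by
    intro k hk
    refine lt_of_lt_of_le ?_ (exp_le_one_add_pow hx0 hx1 k)
    rw [← Real.log_lt_iff_lt_exp hMpos]
    have : (k : ℝ) * (100 * φ) ≤ k * ψ :=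
      mul_le_mul_of_nonneg_left (by linarith) (Nat.cast_nonneg _)
    linarith
  have hsmall : ∀ i, 1 ≤ i → (volIn G B (levelSet s.label B i) : ℝ) ≤ M := fun i hi =>
    (volIn_le_vol G _ _).trans (hs.vol_le_total fun v hv => Or.inl
      (by have := (mem_levelSet.1 hv).2; omega))
  have hi1 : ∀ i, q ≤ i → 1 / φ ≤ (i : ℝ) - 1 := fun i hi => by
    have : (q : ℝ) ≤ i := by exact_mod_cast hi
    linarith
  have hq1 : 1 ≤ q := by omega
  -- some level set at or above `p` has more than half of the volume
  have hlarge : ∃ i, p ≤ i ∧ (volIn G B B : ℝ) < 2 * volIn G B (levelSet s.label B i) := by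
    by_contra hcon
    push Not at hcon
    -- Descending from the top vertex, small level sets expand geometrically, which would give more
    -- volume than there is mass.
    have hgrow : ∀ k, k ≤ N - p →
        (1 + ψ / 4) ^ k ≤ (volIn G B (levelSet s.label B (N - k)) : ℝ) := by
      intro k
      induction k with
      | zero =>
        intro _
        have hv1 : ({v} : Finset V) ⊆ levelSet s.label B (N - 0) := by
          rw [Finset.singleton_subset_iff, mem_levelSet]
          exact ⟨hvB, by omega⟩
        have := volIn_mono G (B := B) hv1
        have h1 : (1 : ℝ) ≤ volIn G B {v} := by exact_mod_cast hpos v hvB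
        simpa using h1.trans this
      | succ k ih =>
        intro hk
        have ihk := ih (by omega)
        have e : N - k = (N - (k + 1)) + 1 := by omega
        have hqi : q ≤ N - k := by omega
        have hi := hi1 _ hqi
        have hhalf := hcon (N - k) (by omega)
        have hcut := hs.cut_levelSet_le hφ hm2 (B := B) (by omega) hi
        have hX := hexp _ (levelSet_subset _ _ _) hhalf
        have hO := hsm _ (levelSet_subset _ _ _) hhalf
        have hvol := vol_eq_volIn_add_cut G B (levelSet s.label B (N - k))
        have hg := volIn_levelSet_add_shortCut_le G s.label B (N - (k + 1))
        rw [← e] at hg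
        rw [hvol] at hcut
        set x : ℝ := (volIn G B (levelSet s.label B (N - k)) : ℝ)
        set O : ℝ := (cut G (levelSet s.label B (N - k)) Bᶜ : ℝ)
        have hx : 0 ≤ x := Nat.cast_nonneg _
        have hO0 : 0 ≤ O := Nat.cast_nonneg _
        have e1 : φ * x ≤ 1 / 100 * ψ * x := by gcongr
        have e2 : φ * O ≤ 1 / 100 * O := by gcongr
        -- Of the cut, which is at least `ψ x`, at most a tenth is offset by the boundary of `B` and
        -- about a hundredth by `φ` times the volume. The rest is at most twice the short cut.
        have e3 : ψ / 4 * x ≤ shortCut G s.label B (N - k) := by linarith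
        calc (1 + ψ / 4) ^ (k + 1) = (1 + ψ / 4) ^ k * (1 + ψ / 4) := pow_succ _ _
          _ ≤ x * (1 + ψ / 4) := by gcongr
          _ ≤ _ := by linarith
    have h1 := hgrow (N - p) le_rfl
    have h2 : N - (N - p) = p := by omega
    rw [h2] at h1
    have h3 := hbig (N - p) (by rw [Nat.cast_sub hpN']; exact hNp)
    linarith [hsmall p (by omega)]
  obtain ⟨i₀, hpi, hlt⟩ := hlarge
  by_contra hcon
  push Not at hcon
  obtain ⟨w, hwB, hw⟩ := hcon
  have hcompl : ∀ i, i ≤ i₀ →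
      2 * (volIn G B (B \ levelSet s.label B i) : ℝ) ≤ volIn G B B := by
    intro i hi
    rw [volIn_sdiff G (levelSet_subset _ _ _)]
    have := volIn_mono G (B := B) (levelSet_anti s.label B hi)
    linarith
  -- Ascending from the unlabelled vertex `w`, the complements now are the small sides. They would
  -- outgrow the level set at `i₀`, whose volume is at most `M`.
  have hgrow : ∀ k, q + k ≤ p →
      (1 + ψ / 4) ^ k ≤ (volIn G B (B \ levelSet s.label B (q + k)) : ℝ) := by
    intro k
    induction k with
    | zero =>
      intro _
      have hv1 : ({w} : Finset V) ⊆ B \ levelSet s.label B (q + 0) := by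
        rw [Finset.singleton_subset_iff, mem_sdiff_levelSet]
        exact ⟨hwB, by omega⟩
      have := volIn_mono G (B := B) hv1
      have h1 : (1 : ℝ) ≤ volIn G B {w} := by exact_mod_cast hpos w hwB
      simpa using h1.trans this
    | succ k ih =>
      intro hk
      have ihk := ih (by omega)
      have hi := hi1 (q + k) (by omega)
      have hhalf := hcompl (q + k) (by omega)
      have hcut := hs.cut_sdiff_levelSet_le hφ hm0 (B := B) hi
      have hX := hexp _ Finset.sdiff_subset hhalf
      have hO := hsm _ Finset.sdiff_subset hhalf
      have hvol := vol_eq_volIn_add_cut G B (B \ levelSet s.label B (q + k))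
      have hg := volIn_sdiff_levelSet_add_shortCut_le G s.label B (q + k)
      rw [Finset.sdiff_sdiff_eq_self (levelSet_subset _ _ _),
        cut_comm G (B \ levelSet s.label B (q + k)) (levelSet s.label B (q + k))] at hX hO
      rw [hvol] at hcut
      set x : ℝ := (volIn G B (B \ levelSet s.label B (q + k)) : ℝ)
      set O : ℝ := (cut G (B \ levelSet s.label B (q + k)) Bᶜ : ℝ)
      have hx : 0 ≤ x := Nat.cast_nonneg _
      have hO0 : 0 ≤ O := Nat.cast_nonneg _
      have e1 : φ * x ≤ 1 / 100 * ψ * x := by gcongr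
      have e2 : φ * O ≤ 1 / 100 * O := by gcongr
      have e3 : ψ / 4 * x ≤ shortCut G s.label B (q + k) := by linarith
      calc (1 + ψ / 4) ^ (k + 1) = (1 + ψ / 4) ^ k * (1 + ψ / 4) := pow_succ _ _
        _ ≤ x * (1 + ψ / 4) := by gcongr
        _ ≤ _ := by rw [← add_assoc]; linarith
  have h1 := hgrow (p - q) (by omega)
  have h2 : q + (p - q) = p := by omega
  rw [h2] at h1
  have h3 := hbig (p - q) (by rw [Nat.cast_sub hqp']; exact hpq)
  have h4 := hcompl p hpi
  have h5 := hsmall i₀ (by omega)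
  linarith

end Saturation

/-! ### Mass leaking out of `B` during one call -/

section Leak

variable {V : Type*} [Fintype V] [DecidableEq V] {G : SimpleGraph V} [DecidableRel G.Adj]

variable {adj : V → List V} {φ : ℝ} {m₀ : V → ℝ} {s : InnerState V}

theorem InnerInv.outflow_le_cut_div (hs : InnerInv G adj φ m₀ s) (B : Finset V) :
    ∑ v ∈ B, ∑ u ∈ Bᶜ, s.flow v u ≤ cut G B Bᶜ / φ := by
  rw [cut_eq_sum, div_eq_mul_one_div, Finset.sum_mul]
  simp only [Finset.sum_mul]
  exact Finset.sum_le_sum fun v _ => Finset.sum_le_sum fun u _ => hs.flow_le_div v u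

theorem min_le_sum_levels (a : ℕ) {x : ℝ} {N : ℕ} (hN : x ≤ N) :
    min (a : ℝ) x ≤ ∑ i ∈ Finset.range N, if i + 1 ≤ a then (1 : ℝ) else 0 := by
  rw [Finset.sum_boole]
  have : (Finset.range N).filter (fun i => i + 1 ≤ a) = Finset.range (min a N) := by
    ext i; simp only [Finset.mem_filter, Finset.mem_range]; omega
  rw [this, Finset.card_range]
  push_cast
  exact min_le_min_left _ hN

/-- Layer-cake summation: an edge leaving `B` at `v` carries at most `min (l(v)) (1/φ)`, hence at
most one unit per level set, up to level `N`, that contains `v`. -/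
theorem InnerInv.outflow_le_sum_cut (hs : InnerInv G adj φ m₀ s) (B : Finset V) {N : ℕ}
    (hN : 1 / φ ≤ N) :
    ∑ v ∈ B, ∑ u ∈ Bᶜ, s.flow v u ≤
      ∑ i ∈ Finset.range N, (cut G (levelSet s.label B (i + 1)) Bᶜ : ℝ) := by
  have h1 : ∀ i, (cut G (levelSet s.label B (i + 1)) Bᶜ : ℝ) =
      ∑ v ∈ B, ∑ u ∈ Bᶜ, adjInd G v u * if i + 1 ≤ s.label v then 1 else 0 := by
    intro i
    rw [cut_eq_sum, levelSet, Finset.sum_filter]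
    refine Finset.sum_congr rfl fun v _ => ?_
    split_ifs <;> simp
  simp only [h1]
  rw [Finset.sum_comm (s := Finset.range N)]
  refine Finset.sum_le_sum fun v _ => ?_
  rw [Finset.sum_comm (s := Finset.range N)]
  refine Finset.sum_le_sum fun u _ => ?_
  rw [← Finset.mul_sum]
  exact (hs.flow_le v u).trans
    (mul_le_mul_of_nonneg_left (min_le_sum_levels _ hN) (adjInd_nonneg G v u))

/-- Steep edges across level `i + 2` carry at least `i + 1` units each, and no more than the total
mass can leave. For level sets of the whole vertex set no boundary term appears. -/
theorem InnerInv.level_cut_le (hs : InnerInv G adj φ m₀ s) (hm0 : ∀ v, 0 ≤ m₀ v) {i : ℕ}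
    (hi : ((i : ℝ) + 1) ≤ 1 / φ) :
    (cut G (levelSet s.label .univ (i + 2)) (.univ \ levelSet s.label .univ (i + 2)) : ℝ) ≤
      (∑ v, m₀ v) * ((i : ℝ) + 1)⁻¹ + 2 * shortCut G s.label .univ (i + 2) := by
  set L := levelSet s.label .univ (i + 2) with hL
  have hbal := hs.mass_balance L
  have h1 : 0 ≤ ∑ v ∈ L, s.mass v := Finset.sum_nonneg fun v _ => hs.mass_nonneg v
  have h2 : ∑ v ∈ L, m₀ v ≤ ∑ v, m₀ v :=
    Finset.sum_le_sum_of_subset_of_nonneg (Finset.subset_univ _) fun v _ _ => hm0 v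
  have hmin : min (((i + 2 : ℕ) : ℝ) - 1) (1 / φ) = (i : ℝ) + 1 := by
    rw [min_eq_left] <;> push_cast <;> linarith
  have h3 : ((i : ℝ) + 1) * ((cut G L (.univ \ L) : ℝ) - 2 * shortCut G s.label .univ (i + 2)) ≤
      ∑ v ∈ L, ∑ u ∈ Lᶜ, s.flow v u := by
    have : ((i : ℝ) + 1) * ((cut G L (.univ \ L) : ℝ) - 2 * shortCut G s.label .univ (i + 2)) =
        ∑ v ∈ L, ∑ u ∈ .univ \ L,
          ((i : ℝ) + 1) * (adjInd G v u - 2 * shortInd G s.label v u) := by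
      rw [cut_eq_sum, shortCut, ← hL]
      simp only [← Finset.mul_sum, Finset.sum_sub_distrib]
    rw [this, Finset.compl_eq_univ_sdiff]
    refine Finset.sum_le_sum fun v hv => Finset.sum_le_sum fun u hu => ?_
    have := hs.crossing_flow (mem_levelSet.1 hv).2 (mem_sdiff_levelSet.1 hu).2
    rwa [hmin] at this
  have hi0 : (0 : ℝ) < (i : ℝ) + 1 := by positivity
  have h4 : (cut G L (.univ \ L) : ℝ) - 2 * shortCut G s.label .univ (i + 2) ≤
      (∑ v, m₀ v) * ((i : ℝ) + 1)⁻¹ := by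
    rw [← div_eq_mul_inv, le_div_iff₀ hi0, mul_comm]
    linarith
  linarith

/-- Telescoping: each short cut is paid for by the volume of the layer where its edges end. -/
theorem sum_shortCut_add_le (l : V → ℕ) (n : ℕ) :
    ∑ i ∈ Finset.range n, shortCut G l .univ (i + 2) +
      volIn G .univ (levelSet l .univ (n + 1)) ≤ (volIn G .univ (levelSet l .univ 1) : ℝ) := by
  induction n with
  | zero => simp
  | succ n ih =>
    rw [Finset.sum_range_succ]
    have := volIn_levelSet_add_shortCut_le G l .univ (n + 1)
    linarith

theorem cut_levelSet_mono (l : V → ℕ) (B : Finset V) (i : ℕ) :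
    (cut G (levelSet l B i) (B \ levelSet l B i) : ℝ) ≤
      cut G (levelSet l .univ i) (.univ \ levelSet l .univ i) := by
  rw [cut_eq_sum, cut_eq_sum]
  have h1 : levelSet l B i ⊆ levelSet l .univ i :=
    Finset.filter_subset_filter _ (Finset.subset_univ _)
  have h2 : B \ levelSet l B i ⊆ .univ \ levelSet l .univ i := fun v hv => by
    rw [mem_sdiff_levelSet] at hv ⊢
    exact ⟨Finset.mem_univ _, hv.2⟩
  refine (Finset.sum_le_sum fun v _ => Finset.sum_le_sum_of_subset_of_nonneg h2
    fun u _ _ => adjInd_nonneg G v u).trans ?_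
  exact Finset.sum_le_sum_of_subset_of_nonneg h1
    fun v _ _ => Finset.sum_nonneg fun u _ => adjInd_nonneg G v u

/-- The total size of the level cuts at levels up to `1 / φ`. -/
theorem InnerInv.sum_level_cut_le (hs : InnerInv G adj φ m₀ s) (hφ : 0 < φ) (hφ1 : φ ≤ 1)
    (hm0 : ∀ v, 0 ≤ m₀ v) (B : Finset V) :
    ∑ i ∈ Finset.range ⌈1 / φ⌉₊,
      (cut G (levelSet s.label B (i + 1)) (B \ levelSet s.label B (i + 1)) : ℝ) ≤
      (∑ v, m₀ v) * (4 + Real.log (1 / φ)) := by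
  set M := ∑ v, m₀ v with hM
  have hM0 : 0 ≤ M := Finset.sum_nonneg fun v _ => hm0 v
  have hφ' : 1 ≤ 1 / φ := by rw [le_div_iff₀ hφ]; linarith
  obtain ⟨n, hn⟩ : ∃ n, ⌈1 / φ⌉₊ = n + 1 :=
    Nat.exists_eq_succ_of_ne_zero (Nat.ceil_pos.2 (by linarith)).ne'
  have hnlt : (n : ℝ) < 1 / φ := by
    have := Nat.ceil_lt_add_one (show 0 ≤ 1 / φ by linarith)
    rw [hn] at this
    push_cast at this
    linarith
  have hL1 : (volIn G .univ (levelSet s.label .univ 1) : ℝ) ≤ M :=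
    (volIn_le_vol G _ _).trans (hs.vol_le_total fun v hv => Or.inl (mem_levelSet.1 hv).2)
  refine (Finset.sum_le_sum fun i _ => cut_levelSet_mono s.label B (i + 1)).trans ?_
  -- Level 1 gives no flow bound, so it is split off and bounded by its volume. It contributes 1 to
  -- the constant 4, the harmonic sum 1, and the short cuts 2.
  rw [hn, Finset.sum_range_succ']
  have h0 : (cut G (levelSet s.label .univ 1) (.univ \ levelSet s.label .univ 1) : ℝ) ≤ M :=
    (cut_le_volIn G (Finset.subset_univ _)).trans hL1
  have h1 : ∑ i ∈ Finset.range n, (cut G (levelSet s.label .univ (i + 1 + 1))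
      (.univ \ levelSet s.label .univ (i + 1 + 1)) : ℝ) ≤
      ∑ i ∈ Finset.range n, (M * ((i : ℝ) + 1)⁻¹ + 2 * shortCut G s.label .univ (i + 2)) := by
    refine Finset.sum_le_sum fun i hi => hs.level_cut_le hm0 ?_
    have : (i : ℝ) + 1 ≤ n := by exact_mod_cast Finset.mem_range.1 hi
    linarith
  rw [Finset.sum_add_distrib, ← Finset.mul_sum, ← Finset.mul_sum] at h1
  have h2 := sum_shortCut_add_le (G := G) s.label n
  have h3 : ∑ i ∈ Finset.range n, ((i : ℝ) + 1)⁻¹ ≤ 1 + Real.log (1 / φ) := by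
    have h := harmonic_le_one_add_log n
    unfold harmonic at h
    push_cast at h
    refine h.trans ?_
    rcases Nat.eq_zero_or_pos n with h0 | h0
    · subst h0
      have := Real.log_nonneg hφ'
      simpa using this
    · have : Real.log n ≤ Real.log (1 / φ) :=
        Real.log_le_log (by exact_mod_cast h0) hnlt.le
      linarith
  have h4 := mul_le_mul_of_nonneg_left h3 hM0
  have h5 : (0 : ℝ) ≤ volIn G .univ (levelSet s.label .univ (n + 1)) := Nat.cast_nonneg _
  simp only [zero_add]
  linarith

/-- The mass that leaks out of `B` while at most half of `B` can be filled. -/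
theorem InnerInv.outflow_le_of_smooth (hs : InnerInv G adj φ m₀ s) (hφ : 0 < φ) (hφ1 : φ ≤ 1)
    (hm0 : ∀ v, 0 ≤ m₀ v) (B : Finset V) {δ : ℝ} (hδ : 0 ≤ δ)
    (hsm : ∀ T, T ⊆ B → 2 * (volIn G B T : ℝ) ≤ volIn G B B →
      (cut G T Bᶜ : ℝ) ≤ δ * cut G T (B \ T))
    (hM : 2 * ∑ v, m₀ v ≤ volIn G B B) :
    ∑ v ∈ B, ∑ u ∈ Bᶜ, s.flow v u ≤ δ * ((∑ v, m₀ v) * (4 + Real.log (1 / φ))) := by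
  refine (hs.outflow_le_sum_cut B (Nat.le_ceil (1 / φ))).trans ?_
  refine le_trans ?_ (mul_le_mul_of_nonneg_left (hs.sum_level_cut_le hφ hφ1 hm0 B) hδ)
  rw [Finset.mul_sum]
  refine Finset.sum_le_sum fun i _ => hsm _ (levelSet_subset _ _ _) ?_
  have : (volIn G B (levelSet s.label B (i + 1)) : ℝ) ≤ ∑ v, m₀ v :=
    (volIn_le_vol G _ _).trans (hs.vol_le_total fun v hv => Or.inl
      (by have := (mem_levelSet.1 hv).2; omega))
  linarith

end Leak

/-! ### The set conductance and its gap below 1 -/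

section SetConductance

variable {V : Type*} [Fintype V] [DecidableEq V] (G : SimpleGraph V) [DecidableRel G.Adj]

theorem volIn_eq_inner_add_cut {B T : Finset V} (h : T ⊆ B) :
    (volIn G B T : ℝ) = ∑ v ∈ T, ∑ u ∈ T, adjInd G v u + cut G T (B \ T) := by
  rw [volIn_eq_sum, cut_eq_sum, ← Finset.sum_add_distrib]
  refine Finset.sum_congr rfl fun v _ => ?_
  rw [add_comm, Finset.sum_sdiff h]

theorem volIn_singleton (B : Finset V) (v : V) :
    (volIn G B {v} : ℝ) = ∑ u ∈ B, adjInd G v u := by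
  rw [volIn_eq_sum, Finset.sum_singleton]

theorem setConductance_mul_min_le {B T : Finset V} (h : T ⊆ B) :
    setConductance G B * min (volIn G B T : ℝ) (volIn G B (B \ T)) ≤ cut G T (B \ T) := by
  set x : ℝ := min (volIn G B T : ℝ) (volIn G B (B \ T)) with hx
  have hx0 : 0 ≤ x := le_min (Nat.cast_nonneg _) (Nat.cast_nonneg _)
  rcases hx0.eq_or_lt with h0 | h0
  · rw [← h0, mul_zero]; exact Nat.cast_nonneg _
  · have h1 : (0 : ℝ) < volIn G B T := lt_of_lt_of_le h0 (min_le_left _ _)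
    have h2 : (0 : ℝ) < volIn G B (B \ T) := lt_of_lt_of_le h0 (min_le_right _ _)
    rw [← le_div_iff₀ h0]
    refine csInf_le ⟨0, ?_⟩ ⟨T, ⟨?_, ?_⟩, rfl⟩
    · rintro _ ⟨S, _, rfl⟩
      positivity
    · by_contra hT
      rw [Finset.not_nonempty_iff_eq_empty] at hT
      simp [hT, volIn] at h1
    · refine h.ssubset_of_ne fun hT => ?_
      simp [hT, volIn] at h2

theorem setConductance_mul_le {B T : Finset V} (h : T ⊆ B)
    (hT : 2 * (volIn G B T : ℝ) ≤ volIn G B B) :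
    setConductance G B * volIn G B T ≤ cut G T (B \ T) := by
  have := setConductance_mul_min_le G h
  rwa [min_eq_left (by rw [volIn_sdiff G h]; linarith)] at this

theorem exists_cut_lt {B : Finset V} (h0 : 0 < setConductance G B) (h1 : setConductance G B < 1) :
    ∃ T, T ⊆ B ∧ (cut G T (B \ T) : ℝ) < min (volIn G B T : ℝ) (volIn G B (B \ T)) := by
  unfold setConductance at h0 h1
  have hne : ((fun T : Finset V =>
      (cut G T (B \ T) : ℝ) / min (volIn G B T : ℝ) (volIn G B (B \ T) : ℝ)) ''
    {T : Finset V | T.Nonempty ∧ T ⊂ B}).Nonempty := by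
    by_contra h
    rw [Set.not_nonempty_iff_eq_empty] at h
    rw [h, Real.sInf_empty] at h0
    exact lt_irrefl _ h0
  obtain ⟨_, ⟨T, hT, rfl⟩, hlt⟩ := exists_lt_of_csInf_lt hne h1
  refine ⟨T, hT.2.subset, ?_⟩
  have hpos : 0 < (cut G T (B \ T) : ℝ) / min (volIn G B T : ℝ) (volIn G B (B \ T) : ℝ) := by
    refine lt_of_lt_of_le h0 (csInf_le ⟨0, ?_⟩ ⟨T, hT, rfl⟩)
    rintro _ ⟨S, _, rfl⟩
    positivity
  have hmin : 0 ≤ min (volIn G B T : ℝ) (volIn G B (B \ T) : ℝ) :=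
    le_min (Nat.cast_nonneg _) (Nat.cast_nonneg _)
  -- A zero denominator makes the ratio 0 in Lean, which `h0` excludes.
  rcases hmin.eq_or_lt with h | h
  · rw [← h] at hpos; simp at hpos
  · simpa [div_lt_one h] using hlt

/-- An isolated vertex would give a ratio 0, and a one-point `B` would give the infimum of the empty
set, which is also 0. -/
theorem one_le_volIn_singleton {B : Finset V} (h0 : 0 < setConductance G B) {v : V}
    (hv : v ∈ B) : 1 ≤ volIn G B {v} := by
  by_contra hcon
  have h00 : volIn G B {v} = 0 := by omega
  unfold setConductance at h0
  by_cases hB : {v} ⊂ B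
  · refine absurd h0 (not_lt.2 (csInf_le ⟨0, ?_⟩ ⟨{v}, ⟨⟨v, by simp⟩, hB⟩, ?_⟩))
    · rintro _ ⟨S, _, rfl⟩
      positivity
    · simp [h00]
  · have hB' : B = {v} := by
      by_contra hne
      exact hB ((Finset.singleton_subset_iff.2 hv).ssubset_of_ne (Ne.symm hne))
    have : {T : Finset V | T.Nonempty ∧ T ⊂ B} = ∅ := by
      ext T
      simp only [Set.mem_ofPred_eq, Set.mem_empty_iff_false, iff_false, not_and, hB']
      intro hT hlt
      rw [Finset.ssubset_singleton_iff] at hlt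
      simp [hlt] at hT
    rw [this] at h0
    simp at h0

/-- The sign vector of a set. -/
noncomputable def signOf (T : Finset V) (v : V) : ℝ := if v ∈ T then 1 else -1

theorem signOf_mul_self (T : Finset V) (v : V) : signOf T v * signOf T v = 1 := by
  unfold signOf; split_ifs <;> norm_num

/-- Toggling the membership of `v` pairs off the subsets with opposite signs. This is pairwise
independence of the signs of a uniformly random subset. -/
theorem sum_powerset_signOf_mul {B : Finset V} {v u : V} (hv : v ∈ B) (hne : v ≠ u) :
    ∑ T ∈ B.powerset, signOf T v * signOf T u = 0 := by
  refine Finset.sum_involution (fun T _ => symmDiff T {v}) ?_ ?_ ?_ ?_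
  · intro T _
    have h1 : signOf (symmDiff T {v}) v = - signOf T v := by
      unfold signOf
      by_cases h : v ∈ T <;> simp [Finset.mem_symmDiff, h]
    have h2 : signOf (symmDiff T {v}) u = signOf T u := by
      unfold signOf
      simp [Finset.mem_symmDiff, hne.symm]
    rw [h1, h2]; ring
  · intro T _ _ h
    have : v ∈ symmDiff T {v} ↔ v ∈ T := by rw [h]
    simp [Finset.mem_symmDiff] at this
  · intro T hT
    rw [Finset.mem_powerset] at hT ⊢
    intro w hw
    rw [Finset.mem_symmDiff] at hw
    rcases hw with hw | hw
    · exact hT hw.1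
    · rw [Finset.mem_singleton.1 hw.1]; exact hv
  · intro T _
    simp

theorem cut_eq_signOf {B T : Finset V} (h : T ⊆ B) :
    (cut G T (B \ T) : ℝ) =
      ∑ v ∈ B, ∑ u ∈ B, adjInd G v u * ((1 - signOf T v * signOf T u) / 4) := by
  have h1 : (cut G T (B \ T) : ℝ) = (cut G T (B \ T) + cut G (B \ T) T) / 2 := by
    rw [cut_comm G (B \ T) T]; ring
  have key : ∀ S S' : Finset V, S ⊆ B → S' ⊆ B → (cut G S S' : ℝ) =
      ∑ v ∈ B, ∑ u ∈ B, adjInd G v u * ((if v ∈ S then 1 else 0) * (if u ∈ S' then 1 else 0)) := by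
    intro S S' hS hS'
    rw [cut_eq_sum, ← Finset.sum_subset hS (fun v _ hv => by simp [hv])]
    refine Finset.sum_congr rfl fun v hv => ?_
    rw [← Finset.sum_subset hS' (fun u _ hu => by simp [hu])]
    exact Finset.sum_congr rfl fun u hu => by simp [hv, hu]
  rw [h1, key T (B \ T) h Finset.sdiff_subset, key (B \ T) T Finset.sdiff_subset h,
    ← Finset.sum_add_distrib, Finset.sum_div]
  refine Finset.sum_congr rfl fun v hv => ?_
  rw [← Finset.sum_add_distrib, Finset.sum_div]
  refine Finset.sum_congr rfl fun u hu => ?_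
  unfold signOf
  by_cases hvT : v ∈ T <;> by_cases huT : u ∈ T <;> simp [hvT, huT, hv, hu] <;> ring

theorem volIn_sub_eq_signOf {B T : Finset V} (h : T ⊆ B) :
    (volIn G B T : ℝ) - volIn G B (B \ T) = ∑ v ∈ B, (volIn G B {v} : ℝ) * signOf T v := by
  rw [← Finset.sum_sdiff h, volIn_eq_sum, volIn_eq_sum]
  have h1 : ∑ v ∈ B \ T, (volIn G B {v} : ℝ) * signOf T v =
      - ∑ v ∈ B \ T, ∑ u ∈ B, adjInd G v u := by
    rw [← Finset.sum_neg_distrib]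
    refine Finset.sum_congr rfl fun v hv => ?_
    rw [volIn_singleton, signOf, if_neg (Finset.mem_sdiff.1 hv).2]; ring
  have h2 : ∑ v ∈ T, (volIn G B {v} : ℝ) * signOf T v =
      ∑ v ∈ T, ∑ u ∈ B, adjInd G v u := by
    refine Finset.sum_congr rfl fun v hv => ?_
    rw [volIn_singleton, signOf, if_pos hv]; ring
  rw [h1, h2]; ring

/-- A random cut has conductance bounded away from `1` unless some degree is very large. -/
theorem setConductance_le_of_degree_le {B : Finset V} {m : ℝ} (hm : 0 < m)
    (h2m : (volIn G B B : ℝ) = 2 * m) (hψ : 0 ≤ setConductance G B)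
    (hd : ∀ v ∈ B, (volIn G B {v} : ℝ) ≤ 8 / 25 * m) : setConductance G B ≤ 5 / 6 := by
  set ψ := setConductance G B
  set Y : Finset V → ℝ := fun T => ∑ v ∈ B, (volIn G B {v} : ℝ) * signOf T v with hY
  have hcard : (0 : ℝ) < B.powerset.card := by
    exact_mod_cast Finset.card_pos.2 ⟨∅, Finset.empty_mem_powerset B⟩
  have hsumd : ∑ v ∈ B, (volIn G B {v} : ℝ) = 2 * m := by
    rw [← h2m, volIn_eq_sum]
    exact Finset.sum_congr rfl fun v _ => volIn_singleton G B v
  have hYsq : ∑ T ∈ B.powerset, Y T ^ 2 ≤ B.powerset.card * (16 / 25 * m ^ 2) := by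
    have h1 : ∀ T, Y T ^ 2 = ∑ v ∈ B, ∑ u ∈ B,
        (volIn G B {v} : ℝ) * volIn G B {u} * (signOf T v * signOf T u) := by
      intro T
      rw [sq, hY, Finset.sum_mul_sum]
      exact Finset.sum_congr rfl fun v _ => Finset.sum_congr rfl fun u _ => by ring
    simp only [h1]
    rw [Finset.sum_comm]
    have h2 : ∀ v ∈ B, ∑ T ∈ B.powerset, ∑ u ∈ B,
        (volIn G B {v} : ℝ) * volIn G B {u} * (signOf T v * signOf T u) =
        B.powerset.card * ((volIn G B {v} : ℝ) * volIn G B {v}) := by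
      intro v hv
      rw [Finset.sum_comm, Finset.sum_eq_single v]
      · simp only [signOf_mul_self, mul_one, Finset.sum_const, nsmul_eq_mul]
      · intro u _ hu
        rw [← Finset.mul_sum, sum_powerset_signOf_mul hv hu.symm, mul_zero]
      · exact fun h => absurd hv h
    rw [Finset.sum_congr rfl h2, ← Finset.mul_sum]
    refine mul_le_mul_of_nonneg_left ?_ hcard.le
    calc ∑ v ∈ B, (volIn G B {v} : ℝ) * volIn G B {v}
        ≤ ∑ v ∈ B, (volIn G B {v} : ℝ) * (8 / 25 * m) :=
          Finset.sum_le_sum fun v hv => mul_le_mul_of_nonneg_left (hd v hv) (Nat.cast_nonneg _)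
      _ = 16 / 25 * m ^ 2 := by rw [← Finset.sum_mul, hsumd]; ring
  have hcut : ∑ T ∈ B.powerset, (cut G T (B \ T) : ℝ) = B.powerset.card * (m / 2) := by
    rw [Finset.sum_congr rfl fun T hT => cut_eq_signOf G (Finset.mem_powerset.1 hT),
      Finset.sum_comm]
    have h2 : ∀ v ∈ B, ∑ T ∈ B.powerset, ∑ u ∈ B,
        adjInd G v u * ((1 - signOf T v * signOf T u) / 4) =
        B.powerset.card * ((∑ u ∈ B, adjInd G v u) / 4) := by
      intro v hv
      rw [Finset.sum_comm, Finset.sum_div, Finset.mul_sum]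
      refine Finset.sum_congr rfl fun u _ => ?_
      by_cases hvu : v = u
      · subst hvu; simp [adjInd]
      · rw [← Finset.mul_sum, ← Finset.sum_div, Finset.sum_sub_distrib,
          sum_powerset_signOf_mul hv hvu]
        simp only [Finset.sum_const, nsmul_eq_mul]
        ring
    rw [Finset.sum_congr rfl h2, ← Finset.mul_sum, ← Finset.sum_div, ← volIn_eq_sum, h2m]
    ring
  have hmin : ∀ T ∈ B.powerset,
      ψ * (m - (Y T ^ 2 / (4 * (4 / 5 * m)) + 4 / 5 * m / 4)) ≤ cut G T (B \ T) := by
    intro T hT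
    have hT' := Finset.mem_powerset.1 hT
    refine le_trans (mul_le_mul_of_nonneg_left ?_ hψ) (setConductance_mul_min_le G hT')
    have hYT : (volIn G B T : ℝ) - volIn G B (B \ T) = Y T := volIn_sub_eq_signOf G hT'
    have hs := volIn_sdiff G hT'
    -- The smaller side has volume `m - |Y| / 2`. The weight `4/5 m` is the bound for the root mean
    -- square of `Y`, so both terms average to at most `m / 5`, leaving `ψ · 3/5 m ≤ m / 2`.
    have hamgm : ∀ y : ℝ, y / 2 ≤ y ^ 2 / (4 * (4 / 5 * m)) + 4 / 5 * m / 4 := by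
      intro y
      have : y ^ 2 / (4 * (4 / 5 * m)) + 4 / 5 * m / 4 - y / 2 =
          (y - 4 / 5 * m) ^ 2 / (4 * (4 / 5 * m)) := by
        field_simp
        ring
      have h0 : 0 ≤ (y - 4 / 5 * m) ^ 2 / (4 * (4 / 5 * m)) := by positivity
      linarith
    have hp := hamgm (Y T)
    have hn := hamgm (-Y T)
    rw [neg_sq] at hn
    refine le_min ?_ ?_ <;> linarith
  have hsum := Finset.sum_le_sum hmin
  rw [hcut, ← Finset.mul_sum, Finset.sum_sub_distrib, Finset.sum_add_distrib,
    ← Finset.sum_div] at hsum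
  simp only [Finset.sum_const, nsmul_eq_mul] at hsum
  have hdiv : (∑ T ∈ B.powerset, Y T ^ 2) / (4 * (4 / 5 * m)) ≤ B.powerset.card * (m / 5) := by
    rw [div_le_iff₀ (by positivity)]
    linarith
  have h3 : ψ * ((B.powerset.card : ℝ) * (3 / 5 * m)) ≤ B.powerset.card * (m / 2) :=
    le_trans (mul_le_mul_of_nonneg_left (by linarith) hψ) hsum
  have h4 : 0 < (B.powerset.card : ℝ) * m := by positivity
  have h5 : ψ * 3 / 5 ≤ 1 / 2 := by
    by_contra hc
    push Not at hc
    have := mul_lt_mul_of_pos_right hc h4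
    linarith
  linarith

/-- A vertex that meets almost all edges, but not all: take all ends of the other edges. -/
theorem setConductance_le_of_dominating {B : Finset V} {m : ℝ}
    (h2m : (volIn G B B : ℝ) = 2 * m) {c : V} (hc : c ∈ B)
    (hd : 7 / 8 * m ≤ (volIn G B {c} : ℝ))
    (hex : ∃ T, T ⊆ B ∧ c ∉ T ∧ (cut G T (B \ T) : ℝ) < volIn G B T) :
    setConductance G B ≤ 1 / 2 := by
  set R := B.erase c with hR
  set W := R.filter (fun v => ∃ u ∈ R, G.Adj v u) with hW
  have hWR : W ⊆ R := Finset.filter_subset _ _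
  have hRB : R ⊆ B := Finset.erase_subset _ _
  have hcW : c ∉ W := fun h => by simpa [hR] using hWR h
  have hnon : ∀ v ∈ R, v ∉ W → ∀ u ∈ R, adjInd G v u = 0 := by
    intro v hv hvW u hu
    have : ¬ G.Adj v u := fun h => hvW (Finset.mem_filter.2 ⟨hv, u, hu, h⟩)
    simp [adjInd, this]
  have hInner : ∑ v ∈ W, ∑ u ∈ W, adjInd G v u = ∑ v ∈ R, ∑ u ∈ R, adjInd G v u := by
    rw [← Finset.sum_subset hWR fun v hv hvW => Finset.sum_eq_zero (hnon v hv hvW)]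
    refine Finset.sum_congr rfl fun v hv => Finset.sum_subset hWR fun u hu huW => ?_
    rw [adjInd_comm]; exact hnon u hu huW v (hWR hv)
  have hinsert : ∀ f : V → ℝ, ∑ v ∈ B, f v = f c + ∑ v ∈ R, f v := fun f =>
    (Finset.add_sum_erase B f hc).symm
  have hRsum : ∑ v ∈ R, ∑ u ∈ R, adjInd G v u = 2 * m - 2 * volIn G B {c} := by
    have h1 := volIn_eq_sum G B B
    rw [h2m, hinsert] at h1
    have h2 : ∑ v ∈ R, ∑ u ∈ B, adjInd G v u =
        ∑ v ∈ R, adjInd G v c + ∑ v ∈ R, ∑ u ∈ R, adjInd G v u := by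
      rw [← Finset.sum_add_distrib]
      exact Finset.sum_congr rfl fun v _ => hinsert _
    have h3 : ∑ v ∈ R, adjInd G v c = ∑ u ∈ B, adjInd G c u := by
      rw [hinsert]
      simp [adjInd, G.adj_comm]
    rw [h2, h3] at h1
    rw [volIn_singleton]
    linarith
  -- A set avoiding `c` whose cut is below its volume contains an edge. This excludes stars, which
  -- have conductance 1.
  have hpos : 0 < ∑ v ∈ R, ∑ u ∈ R, adjInd G v u := by
    obtain ⟨T, hTB, hcT, hlt⟩ := hex
    rw [volIn_eq_inner_add_cut G hTB] at hlt
    have hTR : T ⊆ R := fun v hv => Finset.mem_erase.2 ⟨fun h => hcT (h ▸ hv), hTB hv⟩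
    have h1 : ∑ v ∈ T, ∑ u ∈ T, adjInd G v u ≤ ∑ v ∈ R, ∑ u ∈ R, adjInd G v u :=
      (Finset.sum_le_sum fun v _ => Finset.sum_le_sum_of_subset_of_nonneg hTR
        fun u _ _ => adjInd_nonneg G v u).trans
        (Finset.sum_le_sum_of_subset_of_nonneg hTR
          fun v _ _ => Finset.sum_nonneg fun u _ => adjInd_nonneg G v u)
    linarith
  have hWB := hWR.trans hRB
  -- Each vertex of `W` has at most one edge to `c` and at least one inside `R`, so at least half of
  -- the volume of `W` is internal.
  have hvolW : (volIn G B W : ℝ) ≤ 2 * ∑ v ∈ R, ∑ u ∈ R, adjInd G v u := by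
    rw [volIn_eq_sum]
    have h1 : ∀ v ∈ W, ∑ u ∈ B, adjInd G v u ≤ 2 * ∑ u ∈ R, adjInd G v u := by
      intro v hv
      rw [hinsert]
      obtain ⟨u, hu, hvu⟩ := (Finset.mem_filter.1 hv).2
      have h2 : (1 : ℝ) ≤ ∑ u ∈ R, adjInd G v u := by
        have := Finset.single_le_sum (fun u _ => adjInd_nonneg G v u) hu
        simpa [adjInd, hvu] using this
      linarith [adjInd_le_one G v c]
    refine (Finset.sum_le_sum h1).trans ?_
    rw [← Finset.mul_sum]
    exact mul_le_mul_of_nonneg_left (Finset.sum_le_sum_of_subset_of_nonneg hWR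
      fun v _ _ => Finset.sum_nonneg fun u _ => adjInd_nonneg G v u) (by norm_num)
  have hsplit := volIn_eq_inner_add_cut G hWB
  rw [hInner] at hsplit
  have hcut0 : (0 : ℝ) ≤ cut G W (B \ W) := Nat.cast_nonneg _
  have hfin := setConductance_mul_le G hWB (by rw [h2m]; linarith)
  have hWpos : (0 : ℝ) < volIn G B W := by linarith
  by_contra hcon
  push Not at hcon
  have := mul_lt_mul_of_pos_right hcon hWpos
  linarith

/-- A vertex with a constant fraction of the volume: take it with some neighbours of low degree. -/
theorem setConductance_le_of_large_degree {B : Finset V} {m : ℝ} (hm : 80 ≤ m)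
    (h2m : (volIn G B B : ℝ) = 2 * m) {c : V} (hc : c ∈ B)
    (hd1 : 8 / 25 * m ≤ (volIn G B {c} : ℝ)) (hd2 : (volIn G B {c} : ℝ) ≤ 7 / 8 * m) :
    setConductance G B ≤ 79 / 80 := by
  set N := B.filter (fun u => G.Adj c u) with hN
  set low := N.filter (fun u => volIn G B {u} ≤ 10) with hlow
  have hsumd : ∑ v ∈ B, (volIn G B {v} : ℝ) = 2 * m := by
    rw [← h2m, volIn_eq_sum]
    exact Finset.sum_congr rfl fun v _ => volIn_singleton G B v
  have hNcard : (N.card : ℝ) = volIn G B {c} := by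
    rw [volIn_singleton, hN, ← Finset.sum_boole]; rfl
  have hcN : c ∉ N := by simp [hN]
  have hNB : N ⊆ B := Finset.filter_subset _ _
  have hlowN : low ⊆ N := Finset.filter_subset _ _
  -- Few neighbours can have degree 11 or more, so more than `m / 80` of them have degree at most
  -- 10.
  have hhigh : ((N \ low).card : ℝ) * 11 ≤ 2 * m - volIn G B {c} := by
    have h1 : ((N \ low).card : ℝ) * 11 ≤ ∑ v ∈ N \ low, (volIn G B {v} : ℝ) := by
      rw [← nsmul_eq_mul]
      refine Finset.card_nsmul_le_sum _ _ _ fun v hv => ?_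
      rw [Finset.mem_sdiff] at hv
      have : 11 ≤ volIn G B {v} := by
        by_contra h; exact hv.2 (Finset.mem_filter.2 ⟨hv.1, by omega⟩)
      exact_mod_cast this
    have h2 : ∑ v ∈ N \ low, (volIn G B {v} : ℝ) ≤ ∑ v ∈ B.erase c, (volIn G B {v} : ℝ) :=
      Finset.sum_le_sum_of_subset_of_nonneg
        (fun v hv => Finset.mem_erase.2 ⟨fun h => hcN (h ▸ (Finset.mem_sdiff.1 hv).1),
          hNB (Finset.mem_sdiff.1 hv).1⟩) fun v _ _ => Nat.cast_nonneg _
    have h3 := Finset.add_sum_erase B (fun v => (volIn G B {v} : ℝ)) hc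
    linarith
  have hcards : ((N \ low).card : ℝ) + low.card = N.card := by
    exact_mod_cast Finset.card_sdiff_add_card_eq_card hlowN
  -- With `k` low neighbours added, the volume is at most `7/8 m + 10 m / 80 = m`, while the edges
  -- to `c` give an internal volume of at least `m / 80`.
  set k := ⌊m / 80⌋₊ with hk
  have hkle : (k : ℝ) ≤ m / 80 := Nat.floor_le (by linarith)
  have hkge : m / 160 ≤ k := by
    have h1 : m / 80 < (k : ℝ) + 1 := Nat.lt_floor_add_one _
    have h2 : (1 : ℝ) ≤ k := by
      have : 1 ≤ k := Nat.le_floor (by push_cast; linarith)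
      exact_mod_cast this
    linarith
  have hklow : k ≤ low.card := by
    have : (k : ℝ) ≤ low.card := by linarith
    exact_mod_cast this
  obtain ⟨K, hKlow, hKcard⟩ := Finset.exists_subset_card_eq hklow
  have hcK : c ∉ K := fun h => hcN (hlowN (hKlow h))
  have hTB : insert c K ⊆ B := Finset.insert_subset hc (hKlow.trans (hlowN.trans hNB))
  have hvol : (volIn G B (insert c K) : ℝ) ≤ m := by
    have h1 : (volIn G B (insert c K) : ℝ) = volIn G B {c} + ∑ v ∈ K, (volIn G B {v} : ℝ) := by
      rw [volIn_eq_sum, Finset.sum_insert hcK, volIn_singleton]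
      congr 1
      exact Finset.sum_congr rfl fun v _ => (volIn_singleton G B v).symm
    have h2 : ∑ v ∈ K, (volIn G B {v} : ℝ) ≤ K.card • (10 : ℝ) :=
      Finset.sum_le_card_nsmul _ _ _ fun v hv => by
        exact_mod_cast (Finset.mem_filter.1 (hKlow hv)).2
    rw [nsmul_eq_mul, hKcard] at h2
    linarith
  have hinner : 2 * (k : ℝ) ≤ ∑ v ∈ insert c K, ∑ u ∈ insert c K, adjInd G v u := by
    have hadj : ∀ u ∈ K, adjInd G c u = 1 := fun u hu => by
      have := (Finset.mem_filter.1 (hlowN (hKlow hu))).2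
      simp [adjInd, this]
    rw [Finset.sum_insert hcK, Finset.sum_insert hcK]
    have h1 : ∑ u ∈ K, adjInd G c u = k := by
      rw [Finset.sum_congr rfl hadj]; simp [hKcard]
    have h2 : (k : ℝ) ≤ ∑ v ∈ K, ∑ u ∈ insert c K, adjInd G v u := by
      rw [← h1]
      refine Finset.sum_le_sum fun v _ => ?_
      rw [Finset.sum_insert hcK, adjInd_comm]
      linarith [Finset.sum_nonneg fun u (_ : u ∈ K) => adjInd_nonneg G v u]
    linarith [adjInd_nonneg G c c]
  have hsplit := volIn_eq_inner_add_cut G hTB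
  have hfin := setConductance_mul_le G hTB (by rw [h2m]; linarith)
  set x : ℝ := (volIn G B (insert c K) : ℝ)
  have hx : 0 < x := by
    have : (0 : ℝ) ≤ cut G (insert c K) (B \ insert c K) := Nat.cast_nonneg _
    linarith
  by_contra hcon
  push Not at hcon
  have := mul_lt_mul_of_pos_right hcon hx
  linarith

/-- Set conductances below `1` are bounded away from `1`. -/
theorem setConductance_le {B : Finset V} (h0 : 0 < setConductance G B)
    (h1 : setConductance G B < 1) : setConductance G B ≤ 79 / 80 := by
  obtain ⟨T, hTB, hT⟩ := exists_cut_lt G h0 h1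
  obtain ⟨m, h2m⟩ : ∃ m : ℝ, (volIn G B B : ℝ) = 2 * m := ⟨volIn G B B / 2, by ring⟩
  have hTm := volIn_sdiff G hTB
  have hcut0 : (0 : ℝ) ≤ cut G T (B \ T) := Nat.cast_nonneg _
  have hminm : min (volIn G B T : ℝ) (volIn G B (B \ T)) ≤ m := by
    rcases le_total (volIn G B T : ℝ) m with h | h
    · exact (min_le_left _ _).trans h
    · exact (min_le_right _ _).trans (by linarith)
  have hm0 : 0 < m := by linarith
  -- In a small graph integrality suffices: the cut misses the smaller volume, itself below 80, by
  -- at least 1.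
  by_cases hm : m < 80
  · have hψ := setConductance_mul_min_le G hTB
    have hint : (cut G T (B \ T) : ℝ) + 1 ≤ min (volIn G B T : ℝ) (volIn G B (B \ T)) := by
      rw [← Nat.cast_min] at hT ⊢
      exact_mod_cast hT
    set x : ℝ := min (volIn G B T : ℝ) (volIn G B (B \ T))
    by_contra hcon
    push Not at hcon
    have := mul_lt_mul_of_pos_right hcon (show 0 < x by linarith)
    linarith
  push Not at hm
  by_cases hall : ∀ v ∈ B, (volIn G B {v} : ℝ) ≤ 8 / 25 * m
  · exact (setConductance_le_of_degree_le G hm0 h2m h0.le hall).trans (by norm_num)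
  push Not at hall
  obtain ⟨c, hc, hd⟩ := hall
  rcases le_total (volIn G B {c} : ℝ) (7 / 8 * m) with h | h
  · exact setConductance_le_of_large_degree G hm h2m hc hd.le h
  · refine (setConductance_le_of_dominating G h2m hc h ?_).trans (by norm_num)
    by_cases hcT : c ∈ T
    · refine ⟨B \ T, Finset.sdiff_subset, fun h => (Finset.mem_sdiff.1 h).2 hcT, ?_⟩
      rw [Finset.sdiff_sdiff_eq_self hTB, cut_comm]
      exact hT.trans_le (min_le_right _ _)
    · exact ⟨T, hTB, hcT, hT.trans_le (min_le_left _ _)⟩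

end SetConductance

/-! ### Summing the leaked fractions over the iterations -/

/-- The mass after the doubling in iteration `j` if none is ever removed. -/
noncomputable def fullMass (d : ℝ) (j : ℕ) : ℝ := d * 2 ^ (j + 1)

/-- A bound for the fraction of `fullMass d j` that leaks out of `B` in iteration `j`. -/
noncomputable def leakFrac (d β β' η₁ η₂ : ℝ) (j : ℕ) : ℝ :=
  if 2 * fullMass d j ≤ β' then η₁ / Real.log β else η₂ * (β / fullMass d j)

theorem fullMass_succ (d : ℝ) (j : ℕ) : fullMass d (j + 1) = 2 * fullMass d j := by
  unfold fullMass; ring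

theorem fullMass_pos {d : ℝ} (hd : 0 < d) (j : ℕ) : 0 < fullMass d j := by
  unfold fullMass; positivity

theorem two_le_fullMass {d : ℝ} (hd : 1 ≤ d) (j : ℕ) : 2 ≤ fullMass d j := by
  induction j with
  | zero => unfold fullMass; norm_num; linarith
  | succ j ih => rw [fullMass_succ]; linarith

theorem count_small_rounds {d β β' : ℝ} (hd : 1 ≤ d) (hβ : 2 ≤ β) (hβ' : β' ≤ β) (n : ℕ) :
    ∑ i ∈ Finset.range n, (if 2 * fullMass d i ≤ β' then (1 : ℝ) else 0) ≤ 2 * Real.log β := by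
  have hlog2 : (1 : ℝ) / 2 ≤ Real.log 2 := by linarith [Real.log_two_gt_d9]
  have hlogβ : 0 ≤ Real.log β := Real.log_nonneg (by linarith)
  rw [Finset.sum_boole]
  have hsub : (Finset.range n).filter (fun i => 2 * fullMass d i ≤ β') ⊆
      Finset.range ⌊2 * Real.log β⌋₊ := by
    intro i hi
    have h1 := (Finset.mem_filter.1 hi).2
    rw [Finset.mem_range]
    refine Nat.lt_of_succ_le (Nat.le_floor ?_)
    have h2 : (2 : ℝ) ^ (i + 1) ≤ β := by
      have h3 : (1 : ℝ) * 2 ^ (i + 1) ≤ fullMass d i := by unfold fullMass; gcongr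
      have := fullMass_pos (show 0 < d by linarith) i
      linarith
    have h4 := Real.log_le_log (by positivity) h2
    rw [Real.log_pow] at h4
    have h5 : ((i + 1 : ℕ) : ℝ) * (1 / 2) ≤ ((i + 1 : ℕ) : ℝ) * Real.log 2 := by gcongr
    linarith
  have h := Finset.card_le_card hsub
  rw [Finset.card_range] at h
  exact le_trans (by exact_mod_cast h) (Nat.floor_le (by linarith))

/-- A geometric series with first term at most 4. The subtracted `2 β / fullMass d n` is its
remaining tail, which makes the induction close. -/
theorem sum_large_rounds {d β β' : ℝ} (hd : 1 ≤ d) (hβ : 0 ≤ β) (hβ' : β / 2 ≤ β') (n : ℕ) :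
    ∑ i ∈ Finset.range n, (if 2 * fullMass d i ≤ β' then 0 else β / fullMass d i) ≤
      max 0 (8 - 2 * (β / fullMass d n)) := by
  induction n with
  | zero => simp
  | succ n ih =>
    have hW := fullMass_pos (show 0 < d by linarith) n
    have hhalf : β / fullMass d (n + 1) = β / fullMass d n / 2 := by
      rw [fullMass_succ]; field_simp
    rw [Finset.sum_range_succ, hhalf]
    split_ifs with h
    · rw [add_zero]
      have h0 : 0 ≤ β / fullMass d n := by positivity
      exact ih.trans (max_le_max_left 0 (by linarith))
    · push Not at h
      have h4 : β / fullMass d n ≤ 4 := by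
        rw [div_le_iff₀ hW]; linarith
      rw [max_eq_right (by linarith)] at ih
      refine le_trans ?_ (le_max_right _ _)
      linarith

theorem sum_leakFrac_le {d β β' η₁ η₂ : ℝ} (hd : 1 ≤ d) (hβ : 2 ≤ β) (hlo : β / 2 ≤ β')
    (hhi : β' ≤ β) (h1 : 0 ≤ η₁) (h2 : 0 ≤ η₂) (n : ℕ) :
    ∑ i ∈ Finset.range n, leakFrac d β β' η₁ η₂ i ≤ 2 * η₁ + 8 * η₂ := by
  have hlogβ : 0 < Real.log β := Real.log_pos (by linarith)
  have hsplit : ∀ i, leakFrac d β β' η₁ η₂ i =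
      η₁ / Real.log β * (if 2 * fullMass d i ≤ β' then (1 : ℝ) else 0) +
      η₂ * (if 2 * fullMass d i ≤ β' then 0 else β / fullMass d i) := by
    intro i
    unfold leakFrac
    split_ifs <;> ring
  simp only [hsplit]
  rw [Finset.sum_add_distrib, ← Finset.mul_sum, ← Finset.mul_sum]
  refine add_le_add ?_ ?_
  · calc _ ≤ η₁ / Real.log β * (2 * Real.log β) :=
        mul_le_mul_of_nonneg_left (count_small_rounds hd hβ hhi n) (by positivity)
      _ = 2 * η₁ := by field_simp
  · have h0 : 0 ≤ β / fullMass d n :=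
      div_nonneg (by linarith) (fullMass_pos (by linarith) n).le
    have := (sum_large_rounds hd (by linarith) hlo n).trans (max_le (by norm_num) (by linarith) : _ ≤ (8 : ℝ))
    calc _ ≤ η₂ * 8 := mul_le_mul_of_nonneg_left this h2
      _ = 8 * η₂ := by ring

/-! ### Invariants over the iterations -/

section Rounds

variable {V : Type*} [Fintype V] [DecidableEq V] (G : SimpleGraph V) [DecidableRel G.Adj]

/-- What the analysis uses about the target cluster `B`, the seed and the parameters: `ψ` is the
internal connectivity, and `η₁`, `η₂` control the leakage in the early and in the late
iterations. -/
structure Setting (B : Finset V) (vs : V) (φ ψ δ η₁ η₂ : ℝ) : Prop where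
  mem : vs ∈ B
  φ_pos : 0 < φ
  φ_le : φ ≤ 1 / 100 * ψ
  ψ_le : ψ ≤ 1
  expand : ∀ T, T ⊆ B → 2 * (volIn G B T : ℝ) ≤ volIn G B B → ψ * volIn G B T ≤ cut G T (B \ T)
  smooth : ∀ T, T ⊆ B → 2 * (volIn G B T : ℝ) ≤ volIn G B B →
    (cut G T Bᶜ : ℝ) ≤ δ * cut G T (B \ T)
  δ_nonneg : 0 ≤ δ
  δ_le : δ ≤ 1 / 10
  one_le : ∀ v ∈ B, 1 ≤ volIn G B {v}
  half_le : (vol G B : ℝ) / 2 ≤ volIn G B B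
  two_le : (2 : ℝ) ≤ vol G B
  early : δ * (4 + Real.log (1 / φ)) ≤ η₁ / Real.log (vol G B)
  late : cut G B Bᶜ / φ ≤ η₂ * vol G B
  η₁_nonneg : 0 ≤ η₁
  η₂_nonneg : 0 ≤ η₂
  leak_le : 2 * η₁ + 8 * η₂ ≤ 1 / 8

variable {G} {B : Finset V} {vs : V} {φ ψ δ η₁ η₂ : ℝ}

theorem Setting.one_le_degree (h : Setting G B vs φ ψ δ η₁ η₂) : (1 : ℝ) ≤ G.degree vs := by
  have h1 := volIn_le_vol G B {vs}
  have h2 : (1 : ℝ) ≤ volIn G B {vs} := by exact_mod_cast h.one_le vs h.mem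
  rw [vol_eq_sum, Finset.sum_singleton] at h1
  linarith

theorem Setting.degree_le (h : Setting G B vs φ ψ δ η₁ η₂) : (G.degree vs : ℝ) ≤ vol G B := by
  rw [vol_eq_sum]
  exact Finset.single_le_sum (f := fun v => (G.degree v : ℝ)) (fun v _ => Nat.cast_nonneg _) h.mem

/-- The bound for the total fraction of leaked mass before iteration `n`. -/
noncomputable def leakSum (G : SimpleGraph V) [DecidableRel G.Adj] (B : Finset V) (vs : V)
    (η₁ η₂ : ℝ) (n : ℕ) : ℝ :=
  ∑ i ∈ Finset.range n, leakFrac (G.degree vs) (vol G B) (volIn G B B) η₁ η₂ i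

theorem Setting.leakSum_le (h : Setting G B vs φ ψ δ η₁ η₂) (n : ℕ) :
    leakSum G B vs η₁ η₂ n ≤ 2 * η₁ + 8 * η₂ :=
  sum_leakFrac_le h.one_le_degree h.two_le h.half_le (volIn_le_vol G B B) h.η₁_nonneg h.η₂_nonneg n

/-- The invariants of the masses `m` at the start of the inner procedure in iteration `j`. -/
structure RoundInv (G : SimpleGraph V) [DecidableRel G.Adj] (B : Finset V) (vs : V)
    (η₁ η₂ : ℝ) (j : ℕ) (m : V → ℝ) : Prop where
  nonneg : ∀ v, 0 ≤ m v
  le_two : ∀ v, m v ≤ 2 * G.degree v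
  two_le : 2 ≤ ∑ v, m v
  total_le : ∑ v, m v ≤ fullMass (G.degree vs) j
  outside : ∑ v ∈ Bᶜ, m v ≤ fullMass (G.degree vs) j * leakSum G B vs η₁ η₂ j
  inside : ∑ v ∈ B, m v = 2 * vol G B ∨
    fullMass (G.degree vs) j * (1 - leakSum G B vs η₁ η₂ j) ≤ ∑ v ∈ B, m v
  fullMass_le : fullMass (G.degree vs) j ≤ 8 * vol G B

theorem RoundInv.start (h : Setting G B vs φ ψ δ η₁ η₂) :
    RoundInv G B vs η₁ η₂ 0 (fun v => 2 * (if v = vs then (G.degree vs : ℝ) else 0)) := by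
  have hd := h.one_le_degree
  have h0 : leakSum G B vs η₁ η₂ 0 = 0 := by simp [leakSum]
  have hW : fullMass (G.degree vs) 0 = 2 * G.degree vs := by unfold fullMass; ring
  have hsum : ∑ v, 2 * (if v = vs then (G.degree vs : ℝ) else 0) = 2 * G.degree vs := by
    simp
  have hB : ∑ v ∈ B, 2 * (if v = vs then (G.degree vs : ℝ) else 0) = 2 * G.degree vs := by
    simp [h.mem]
  constructor
  · intro v; split_ifs <;> linarith
  · intro v
    split_ifs with hv
    · rw [hv]
    · rw [mul_zero]; positivity
  · rw [hsum]; linarith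
  · rw [hsum, hW]
  · rw [h0, mul_zero]
    refine (Finset.sum_eq_zero fun v hv => ?_).le
    have : v ≠ vs := fun e => (Finset.mem_compl.1 hv) (e ▸ h.mem)
    simp [this]
  · right; rw [hB, hW, h0]; linarith
  · rw [hW]; linarith [h.degree_le]

variable {adj : V → List V} {m₀ : V → ℝ} {s : InnerState V} {j : ℕ}

theorem Setting.outflow_le_late (h : Setting G B vs φ ψ δ η₁ η₂) (hs : InnerInv G adj φ m₀ s) :
    ∑ v ∈ B, ∑ u ∈ Bᶜ, s.flow v u ≤ η₂ * vol G B :=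
  (hs.outflow_le_cut_div B).trans h.late

theorem Setting.outflow_le (h : Setting G B vs φ ψ δ η₁ η₂) (hs : InnerInv G adj φ m₀ s)
    (hr : RoundInv G B vs η₁ η₂ j m₀) :
    ∑ v ∈ B, ∑ u ∈ Bᶜ, s.flow v u ≤ fullMass (G.degree vs) j *
      leakFrac (G.degree vs) (vol G B) (volIn G B B) η₁ η₂ j := by
  have hW := fullMass_pos (show (0 : ℝ) < G.degree vs by linarith [h.one_le_degree]) j
  unfold leakFrac
  split_ifs with hsmall
  · have hφ1 : φ ≤ 1 := by linarith [h.φ_le, h.ψ_le]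
    have h1 := hs.outflow_le_of_smooth h.φ_pos hφ1 hr.nonneg B h.δ_nonneg h.smooth
      (by linarith [hr.total_le])
    have hlog : 0 < Real.log (vol G B) := Real.log_pos (by linarith [h.two_le])
    have hη := h.η₁_nonneg
    calc _ ≤ δ * ((∑ v, m₀ v) * (4 + Real.log (1 / φ))) := h1
      _ = (∑ v, m₀ v) * (δ * (4 + Real.log (1 / φ))) := by ring
      _ ≤ (∑ v, m₀ v) * (η₁ / Real.log (vol G B)) :=
        mul_le_mul_of_nonneg_left h.early (by linarith [hr.two_le])
      _ ≤ _ := mul_le_mul_of_nonneg_right hr.total_le (by positivity)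
  · have := h.outflow_le_late hs
    have e : fullMass (G.degree vs) j * (η₂ * (vol G B / fullMass (G.degree vs) j)) =
        η₂ * vol G B := by field_simp
    rw [e]; exact this

theorem truncate_le_mass (m : V → ℝ) (v : V) : truncate G m v ≤ m v := min_le_left _ _

theorem truncate_le_degree (m : V → ℝ) (v : V) : truncate G m v ≤ G.degree v := min_le_right _ _

theorem sum_truncate_le_vol (m : V → ℝ) (A : Finset V) :
    ∑ v ∈ A, truncate G m v ≤ vol G A := by
  rw [vol_eq_sum]
  exact Finset.sum_le_sum fun v _ => truncate_le_degree m v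

/-- At the end of the inner procedure little mass is outside of `B`. -/
theorem Setting.outside_le (h : Setting G B vs φ ψ δ η₁ η₂) (hs : InnerInv G adj φ m₀ s)
    (hr : RoundInv G B vs η₁ η₂ j m₀) :
    ∑ v ∈ Bᶜ, truncate G s.mass v ≤
      fullMass (G.degree vs) j * leakSum G B vs η₁ η₂ (j + 1) := by
  have h1 := hs.mass_balance B
  have h2 := hs.mass_total
  rw [← Finset.sum_add_sum_compl B, ← Finset.sum_add_sum_compl B m₀] at h2
  have h3 := h.outflow_le hs hr
  have h4 : ∑ v ∈ Bᶜ, truncate G s.mass v ≤ ∑ v ∈ Bᶜ, s.mass v :=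
    Finset.sum_le_sum fun v _ => truncate_le_mass _ v
  have h5 := hr.outside
  rw [leakSum, Finset.sum_range_succ, mul_add, ← leakSum]
  linarith

/-- At the end of the inner procedure `B` is saturated or has kept its mass. -/
theorem Setting.saturated_or (h : Setting G B vs φ ψ δ η₁ η₂) (hs : InnerInv G adj φ m₀ s)
    (hr : RoundInv G B vs η₁ η₂ j m₀) (hQ : ∀ v, ¬ IsActive G s v) :
    (∀ v ∈ B, (G.degree v : ℝ) ≤ s.mass v) ∨
      fullMass (G.degree vs) j * (1 - leakSum G B vs η₁ η₂ (j + 1)) ≤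
        ∑ v ∈ B, truncate G s.mass v := by
  -- Excess in `B` at the end forces a label at the limit, hence saturation. Without excess,
  -- truncation removes nothing from `B`.
  by_cases hex : ∃ v ∈ B, (G.degree v : ℝ) < s.mass v
  · left
    obtain ⟨v, hvB, hv⟩ := hex
    have hlim : s.limit ≤ s.label v := by
      by_contra hcon
      push Not at hcon
      refine hQ v ⟨hcon, ?_⟩
      unfold excess
      exact lt_max_of_lt_left (by linarith)
    have hsm : ∀ T, T ⊆ B → 2 * (volIn G B T : ℝ) ≤ volIn G B B →
        10 * (cut G T Bᶜ : ℝ) ≤ cut G T (B \ T) := by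
      intro T hT hT2
      have h1 := h.smooth T hT hT2
      have h2 := mul_le_mul_of_nonneg_right h.δ_le (Nat.cast_nonneg (α := ℝ) (cut G T (B \ T)))
      linarith
    intro w hw
    exact hs.full w (Or.inl (hs.label_pos h.φ_pos hr.nonneg hr.le_two h.ψ_le h.φ_le hr.two_le
      h.expand hsm h.one_le ⟨v, hvB, hlim⟩ w hw))
  · right
    push Not at hex
    have htr : ∑ v ∈ B, truncate G s.mass v = ∑ v ∈ B, s.mass v :=
      Finset.sum_congr rfl fun v hv => min_eq_left (hex v hv)
    have hle := sum_truncate_le_vol (G := G) s.mass B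
    have h1 := hs.mass_balance B
    have h2 := h.outflow_le hs hr
    have h3 := h.outflow_le_late hs
    have hβ := h.two_le
    have hη₂ : η₂ ≤ 1 / 64 := by linarith [h.leak_le, h.η₁_nonneg]
    rw [htr] at hle ⊢
    -- A saturated start cannot end without excess: `2 vol(B)` minus the leak exceeds `vol(B)`.
    rcases hr.inside with h4 | h4
    · have : η₂ * vol G B ≤ 1 / 64 * vol G B := by gcongr
      linarith
    · rw [leakSum, Finset.sum_range_succ, ← leakSum]
      linarith

theorem RoundInv.next (h : Setting G B vs φ ψ δ η₁ η₂) (hs : InnerInv G adj φ m₀ s)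
    (hr : RoundInv G B vs η₁ η₂ j m₀) (hQ : ∀ v, ¬ IsActive G s v)
    (hm : 1 / 2 * (2 * G.degree vs * 2 ^ j) < ∑ v, truncate G s.mass v) :
    RoundInv G B vs η₁ η₂ (j + 1) (fun v => 2 * truncate G s.mass v) := by
  have hd := h.one_le_degree
  have hW : 1 / 2 * (2 * (G.degree vs : ℝ) * 2 ^ j) = fullMass (G.degree vs) j / 2 := by
    unfold fullMass; ring
  have hW2 := two_le_fullMass hd j
  rw [hW] at hm
  have hout := h.outside_le hs hr
  have hS := (h.leakSum_le (j + 1)).trans h.leak_le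
  constructor
  · intro v
    have : 0 ≤ truncate G s.mass v := le_min (hs.mass_nonneg v) (Nat.cast_nonneg _)
    linarith
  · intro v
    linarith [truncate_le_degree (G := G) s.mass v]
  · rw [← Finset.mul_sum]; linarith
  · rw [← Finset.mul_sum, fullMass_succ]
    have h1 : ∑ v, truncate G s.mass v ≤ ∑ v, s.mass v :=
      Finset.sum_le_sum fun v _ => truncate_le_mass _ v
    rw [hs.mass_total] at h1
    linarith [hr.total_le]
  · rw [← Finset.mul_sum, fullMass_succ, mul_assoc]
    linarith
  · rw [← Finset.mul_sum, fullMass_succ, mul_assoc]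
    refine (h.saturated_or hs hr hQ).imp (fun hsat => ?_) fun hkeep => by linarith
    rw [vol_eq_sum]
    congr 1
    exact Finset.sum_congr rfl fun v hv => min_eq_right (hsat v hv)
  -- Continuing needs more than half of the full mass. At most `vol(B)` of it is in `B` and at most
  -- an eighth of the full mass outside, so the full mass is below `8/3 vol(B)` before doubling.
  · rw [fullMass_succ]
    have h1 := sum_truncate_le_vol (G := G) s.mass B
    have h2 := Finset.sum_add_sum_compl B (truncate G s.mass)
    have h3 : fullMass (G.degree vs) j * leakSum G B vs η₁ η₂ (j + 1) ≤
        fullMass (G.degree vs) j * (1 / 8) := mul_le_mul_of_nonneg_left hS (by linarith)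
    linarith [h.two_le]

theorem Setting.recovered_sdiff (h : Setting G B vs φ ψ δ η₁ η₂) (hs : InnerInv G adj φ m₀ s)
    (hr : RoundInv G B vs η₁ η₂ j m₀) :
    (vol G (recovered G (truncate G s.mass) \ B) : ℝ) ≤
      8 * (2 * η₁ + 8 * η₂) * vol G B := by
  have hW := fullMass_pos (show (0 : ℝ) < G.degree vs by linarith [h.one_le_degree]) j
  have hη : 0 ≤ 2 * η₁ + 8 * η₂ := by linarith [h.η₁_nonneg, h.η₂_nonneg]
  rw [vol_eq_sum]
  calc ∑ v ∈ recovered G (truncate G s.mass) \ B, (G.degree v : ℝ)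
      ≤ ∑ v ∈ recovered G (truncate G s.mass) \ B, truncate G s.mass v := by
        refine Finset.sum_le_sum fun v hv => ?_
        have := (Finset.mem_sdiff.1 hv).1
        simpa [recovered] using this
    _ ≤ ∑ v ∈ Bᶜ, truncate G s.mass v := by
        refine Finset.sum_le_sum_of_subset_of_nonneg (fun v hv => ?_)
          fun v _ _ => le_min (hs.mass_nonneg v) (Nat.cast_nonneg _)
        exact Finset.mem_compl.2 (Finset.mem_sdiff.1 hv).2
    _ ≤ fullMass (G.degree vs) j * leakSum G B vs η₁ η₂ (j + 1) := h.outside_le hs hr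
    _ ≤ fullMass (G.degree vs) j * (2 * η₁ + 8 * η₂) :=
        mul_le_mul_of_nonneg_left (h.leakSum_le _) hW.le
    _ ≤ 8 * vol G B * (2 * η₁ + 8 * η₂) := mul_le_mul_of_nonneg_right hr.fullMass_le hη
    _ = _ := by ring

/-- An unsaturated `B` still holds 7/8 of the full mass. This exceeds the stopping threshold of one
half, and when `j ≥ t` it also exceeds `vol(B)`, since then the full mass is at least `2 vol(B)`. -/
theorem Setting.sdiff_recovered (h : Setting G B vs φ ψ δ η₁ η₂) (hs : InnerInv G adj φ m₀ s)
    (hr : RoundInv G B vs η₁ η₂ j m₀) (hQ : ∀ v, ¬ IsActive G s v) {t : ℕ}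
    (ht : 2 * Real.log ((vol G B : ℝ) / G.degree vs) ≤ t)
    (hm : ∑ v, truncate G s.mass v ≤ 1 / 2 * (2 * G.degree vs * 2 ^ j) ∨ t ≤ j) :
    B \ recovered G (truncate G s.mass) = ∅ := by
  have hd := h.one_le_degree
  have hW : 1 / 2 * (2 * (G.degree vs : ℝ) * 2 ^ j) = fullMass (G.degree vs) j / 2 := by
    unfold fullMass; ring
  have hW2 := two_le_fullMass hd j
  have hS := (h.leakSum_le (j + 1)).trans h.leak_le
  rcases h.saturated_or hs hr hQ with hsat | hkeep
  · rw [Finset.sdiff_eq_empty_iff_subset]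
    intro v hv
    have : truncate G s.mass v = G.degree v := min_eq_right (hsat v hv)
    simp [recovered, this]
  · exfalso
    have h3 : fullMass (G.degree vs) j * (7 / 8) ≤
        fullMass (G.degree vs) j * (1 - leakSum G B vs η₁ η₂ (j + 1)) :=
      mul_le_mul_of_nonneg_left (by linarith) (by linarith)
    rcases hm with hm | hm
    · rw [hW] at hm
      have h4 : ∑ v ∈ B, truncate G s.mass v ≤ ∑ v, truncate G s.mass v :=
        Finset.sum_le_sum_of_subset_of_nonneg (Finset.subset_univ _)
          fun v _ _ => le_min (hs.mass_nonneg v) (Nat.cast_nonneg _)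
      linarith
    · have h4 := sum_truncate_le_vol (G := G) s.mass B
      have hd0 : (0 : ℝ) < G.degree vs := by linarith
      have hβ : (0 : ℝ) < vol G B := by linarith [h.two_le]
      have hlog : Real.log ((vol G B : ℝ) / G.degree vs) ≤ Real.log (2 ^ j) := by
        rw [Real.log_pow]
        have h5 : (t : ℝ) ≤ j := by exact_mod_cast hm
        have h6 : (j : ℝ) * (1 / 2) ≤ j * Real.log 2 :=
          mul_le_mul_of_nonneg_left (by linarith [Real.log_two_gt_d9]) (Nat.cast_nonneg _)
        linarith
      have h5 := (Real.log_le_log_iff (by positivity) (by positivity)).1 hlog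
      rw [div_le_iff₀ hd0] at h5
      have h6 : fullMass (G.degree vs) j = 2 * (2 ^ j * G.degree vs) := by unfold fullMass; ring
      linarith

/-- A bound for the time per unit of `fullMass` that one iteration takes. -/
noncomputable def timeRate (φ β : ℝ) : ℝ := 6 * Real.log (8 * β) / φ + 6

theorem Setting.round_time_le (h : Setting G B vs φ ψ δ η₁ η₂) (hs : InnerInv G adj φ m₀ s)
    (hr : RoundInv G B vs η₁ η₂ j m₀) {n : ℕ} (ht : TimeInv G n s) :
    (n : ℝ) + overhead G s ≤ timeRate φ (vol G B) * fullMass (G.degree vs) j := by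
  have hφ := h.φ_pos
  have hM := hr.two_le
  have hlogM : 0 ≤ Real.log (∑ v, m₀ v) := Real.log_nonneg (by linarith)
  have hlog : Real.log (∑ v, m₀ v) ≤ Real.log (8 * vol G B) :=
    Real.log_le_log (by linarith) (hr.total_le.trans hr.fullMass_le)
  have hlim : s.limit = 3 * Real.log (∑ v, m₀ v) / φ := hs.limit_eq
  have hlim0 : 0 ≤ s.limit := by rw [hlim]; positivity
  have hlimle : s.limit ≤ 3 * Real.log (8 * vol G B) / φ := by rw [hlim]; gcongr
  have h1 := ht.count_le hs hlim0
  have h2 := ht.overhead_le hs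
  have h3 : timeRate φ (vol G B) = 2 * (3 * Real.log (8 * vol G B) / φ) + 6 := by
    unfold timeRate; ring
  calc (n : ℝ) + overhead G s ≤ (2 * s.limit + 6) * ∑ v, m₀ v := by linarith
    _ ≤ (2 * s.limit + 6) * fullMass (G.degree vs) j :=
      mul_le_mul_of_nonneg_left hr.total_le (by linarith)
    _ ≤ timeRate φ (vol G B) * fullMass (G.degree vs) j := by
      refine mul_le_mul_of_nonneg_right ?_ (fullMass_pos (by linarith [h.one_le_degree]) j).le
      rw [h3]; linarith

variable (G) in
/-- The invariant of the configurations that an execution of the algorithm reaches. -/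
def ConfigInv (adj : V → List V) (B : Finset V) (vs : V) (φ η₁ η₂ : ℝ) (n : ℕ) : Config V → Prop
  | .inner j s => ∃ m₀, RoundInv G B vs η₁ η₂ j m₀ ∧ InnerInv G adj φ m₀ s ∧
      ((∃ k : ℕ, 1 / φ = k) → ∃ n' : ℕ, TimeInv G n' s ∧
        (n : ℝ) ≤ n' + timeRate φ (vol G B) * fullMass (G.degree vs) j)
  | .done m => (vol G (recovered G m \ B) : ℝ) ≤ 8 * (2 * η₁ + 8 * η₂) * vol G B ∧
      B \ recovered G m = ∅ ∧
      ((∃ k : ℕ, 1 / φ = k) → (n : ℝ) ≤ 16 * timeRate φ (vol G B) * vol G B)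

theorem Setting.timeRate_nonneg (h : Setting G B vs φ ψ δ η₁ η₂) :
    0 ≤ timeRate φ (vol G B) := by
  have := h.φ_pos
  have : 0 ≤ Real.log (8 * vol G B) := Real.log_nonneg (by linarith [h.two_le])
  unfold timeRate
  positivity

theorem Setting.configInv_of_run (h : Setting G B vs φ ψ δ η₁ η₂) (hadj : IsAdjacencyList G adj)
    {t : ℕ} (ht : 2 * Real.log ((vol G B : ℝ) / G.degree vs) ≤ t) {n : ℕ} {c : Config V}
    (hrun : Run G adj vs φ (1 / 2) t n c) : ConfigInv G adj B vs φ η₁ η₂ n c := by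
  have hrate := h.timeRate_nonneg
  have hW : ∀ j, 0 < fullMass (G.degree vs) j :=
    fullMass_pos (by linarith [h.one_le_degree])
  induction hrun with
  | start =>
    have hr := RoundInv.start h
    refine ⟨_, hr, InnerInv.init G adj φ _ h.φ_pos hr.nonneg hr.le_two, fun _ => ⟨0, ?_, ?_⟩⟩
    · refine TimeInv.init φ _ fun v => ⟨2 * (if v = vs then (G.degree vs : ℤ) else 0), ?_⟩
      push_cast
      rfl
    · have := mul_nonneg hrate (hW 0).le
      push_cast
      linarith
  | step n k c c' _ hstep ih =>
    cases hstep with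
    | inner j s s' hstep =>
      obtain ⟨m₀, hr, hs, htime⟩ := ih
      refine ⟨m₀, hr, hs.step hadj hstep, fun hφ => ?_⟩
      obtain ⟨n', hn', hle⟩ := htime hφ
      refine ⟨n' + 1, hn'.step hadj hφ hs hstep, ?_⟩
      push_cast
      linarith
    | next j s hQ hm hj =>
      obtain ⟨m₀, hr, hs, htime⟩ := ih
      have hr' := RoundInv.next h hs hr hQ hm
      refine ⟨_, hr', InnerInv.init G adj φ _ h.φ_pos hr'.nonneg hr'.le_two, fun hφ => ?_⟩
      obtain ⟨n', hn', hle⟩ := htime hφ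
      refine ⟨0, TimeInv.init φ _ fun v => ?_, ?_⟩
      · obtain ⟨z, hz⟩ := hn'.mass_int v
        refine ⟨2 * min z (G.degree v), ?_⟩
        unfold truncate
        rw [hz]
        push_cast
        rfl
      -- The full mass doubles, so the time of all earlier iterations together is charged to the
      -- full mass of the current one.
      · have := h.round_time_le hs hr hn'
        rw [fullMass_succ]
        push_cast
        linarith
    | finish j s hQ hm =>
      obtain ⟨m₀, hr, hs, htime⟩ := ih
      refine ⟨h.recovered_sdiff hs hr, h.sdiff_recovered hs hr hQ ht hm, fun hφ => ?_⟩
      obtain ⟨n', hn', hle⟩ := htime hφ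
      have h1 := h.round_time_le hs hr hn'
      have h2 := mul_le_mul_of_nonneg_left hr.fullMass_le hrate
      push_cast
      linarith

theorem ConfigInv.time_le (h : Setting G B vs φ ψ δ η₁ η₂) {n : ℕ} {c : Config V}
    (hc : ConfigInv G adj B vs φ η₁ η₂ n c) (hφ : ∃ k : ℕ, 1 / φ = k) :
    (n : ℝ) ≤ 16 * timeRate φ (vol G B) * vol G B := by
  cases c with
  | inner j s =>
    obtain ⟨m₀, hr, hs, htime⟩ := hc
    obtain ⟨n', hn', hle⟩ := htime hφ
    have h1 := h.round_time_le hs hr hn'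
    have h2 := mul_le_mul_of_nonneg_left hr.fullMass_le h.timeRate_nonneg
    have h3 : (0 : ℝ) ≤ overhead G s := Nat.cast_nonneg _
    linarith
  | done m => exact hc.2.2 hφ

theorem Setting.time_le (h : Setting G B vs φ ψ δ η₁ η₂) {c₁ : ℝ} (hc₁ : 0 < c₁) (hψ : 0 < ψ)
    (hφ : c₁ * ψ ≤ φ) :
    16 * timeRate φ (vol G B) * vol G B ≤
      400 / c₁ * (vol G B * Real.log (vol G B) / ψ) := by
  have hβ := h.two_le
  have hφ0 := h.φ_pos
  have hlog : 0.69 ≤ Real.log (vol G B) :=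
    le_trans (by linarith [Real.log_two_gt_d9]) (Real.log_le_log (by norm_num) hβ)
  have hlog8 : Real.log (8 * vol G B) ≤ 4 * Real.log (vol G B) := by
    have h2 : Real.log 2 ≤ Real.log (vol G B) := Real.log_le_log (by norm_num) hβ
    rw [Real.log_mul (by norm_num) (by linarith), show (8 : ℝ) = 2 ^ 3 by norm_num, Real.log_pow]
    push_cast
    linarith
  have hφ1 : φ ≤ 1 / 100 := by linarith [h.φ_le, h.ψ_le]
  have h1 : timeRate φ (vol G B) ≤ 25 * (Real.log (vol G B) / φ) := by
    have e1 : 6 ≤ Real.log (vol G B) / φ := by rw [le_div_iff₀ hφ0]; linarith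
    have e2 : 6 * Real.log (8 * vol G B) / φ ≤ 6 * (4 * Real.log (vol G B)) / φ := by gcongr
    have e3 : 6 * (4 * Real.log (vol G B)) / φ = 24 * (Real.log (vol G B) / φ) := by ring
    unfold timeRate
    linarith
  have h2 : Real.log (vol G B) / φ ≤ Real.log (vol G B) / (c₁ * ψ) := by
    gcongr
  calc 16 * timeRate φ (vol G B) * vol G B
      ≤ 16 * (25 * (Real.log (vol G B) / (c₁ * ψ))) * vol G B := by
        gcongr
        linarith
    _ = _ := by field_simp; ring

end Rounds

/-! ### Progress, choice of parameters, and the conclusion -/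

/-- An execution can always be continued before it returns. -/
theorem exists_step {V : Type*} [Fintype V] [DecidableEq V] (G : SimpleGraph V)
    [DecidableRel G.Adj] (adj : V → List V) (vs : V) (φ τ : ℝ) (t : ℕ) (j : ℕ)
    (s : InnerState V) : ∃ (k : ℕ) (c : Config V), Step G adj vs φ τ t (.inner j s) k c := by
  classical
  by_cases hQ : ∀ v, ¬ IsActive G s v
  · by_cases hm : ∑ v, truncate G s.mass v ≤ τ * (2 * G.degree vs * 2 ^ j) ∨ t ≤ j
    · exact ⟨_, _, .finish j s hQ hm⟩
    · push Not at hm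
      exact ⟨_, _, .next j s hQ hm.1 hm.2⟩
  · push Not at hQ
    obtain ⟨v₀, hv₀⟩ := hQ
    obtain ⟨v, hv, hmin⟩ := Finset.exists_min_image
      (Finset.univ.filter fun v => IsActive G s v) s.label ⟨v₀, by simpa using hv₀⟩
    have hlow : IsLowestActive G s v :=
      ⟨by simpa using hv, fun w hw => hmin w (by simpa using hw)⟩
    by_cases he : ∀ u, (adj v)[s.current v]? = some u → ¬ IsEligible φ s v u
    · rcases lt_or_ge (s.current v + 1) (adj v).length with hlt | hge
      · exact ⟨_, _, .inner j s _ (.advance s v hlow he hlt)⟩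
      · exact ⟨_, _, .inner j s _ (.relabel s v hlow he hge)⟩
    · push Not at he
      obtain ⟨u, hu, he⟩ := he
      exact ⟨_, _, .inner j s _ (.push s v u hlow hu he)⟩

/-- The leakage constant: `4 + log (1 / φ) ≤ leakConst c₁ * log (1 / φ_S(B))`. -/
noncomputable def leakConst (c₁ : ℝ) : ℝ := 80 * (4 + Real.log (1 / c₁)) + 1

/-- Early leakage is governed by smoothness (`σ₂`), late leakage by the small boundary of `B`
(`σ₁`). -/
theorem exists_setting {V : Type*} [Fintype V] [DecidableEq V] (G : SimpleGraph V)
    [DecidableRel G.Adj] {c₁ : ℝ} (hc₁ : 0 < c₁) (hc₁' : c₁ ≤ 1 / 100) {B : Finset V}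
    (hvol : 2 * vol G B ≤ vol G Finset.univ) (h0 : 0 < setConductance G B)
    (h1 : setConductance G B < 1) {σ₁ σ₂ : ℝ}
    (hσ₁ : 16 * leakConst c₁ + 64 / c₁ + 1600 ≤ σ₁)
    (hσ₂ : 16 * leakConst c₁ + 64 / c₁ + 1600 ≤ σ₂)
    (hint : InternallyConnected G B σ₁) (hsm : Smooth G B σ₂) {vs : V} (hvs : vs ∈ B) {φ : ℝ}
    (hφ₁ : c₁ * setConductance G B ≤ φ) (hφ₂ : φ ≤ 1 / 100 * setConductance G B) :
    ∃ δ, Setting G B vs φ (setConductance G B) δ (leakConst c₁ / σ₂) (1 / (c₁ * σ₁)) := by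
  set ψ := setConductance G B with hψ
  have hψ80 : ψ ≤ 79 / 80 := setConductance_le G h0 h1
  have hφ : 0 < φ := lt_of_lt_of_le (by positivity) hφ₁
  have hlogc : 0 ≤ Real.log (1 / c₁) := Real.log_nonneg (by
    rw [le_div_iff₀ hc₁]; linarith)
  have hD : 0 < leakConst c₁ := by unfold leakConst; positivity
  have hc64 : 0 < 64 / c₁ := by positivity
  have hσ₁0 : 1600 ≤ σ₁ := by linarith
  have hσ₂0 : 1600 ≤ σ₂ := by linarith
  -- the volume of `B`
  have hcutlt := exists_cut_lt G h0 h1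
  have hβ2 : (2 : ℝ) ≤ vol G B := by
    obtain ⟨T, hTB, hT⟩ := hcutlt
    have h2 := volIn_sdiff G hTB
    have h3 : (0 : ℝ) < min (volIn G B T : ℝ) (volIn G B (B \ T)) :=
      lt_of_le_of_lt (Nat.cast_nonneg _) hT
    have h4 : 1 ≤ volIn G B T := by
      exact_mod_cast lt_of_lt_of_le h3 (min_le_left _ _)
    have h5 : 1 ≤ volIn G B (B \ T) := by
      exact_mod_cast lt_of_lt_of_le h3 (min_le_right _ _)
    have h4' : (1 : ℝ) ≤ volIn G B T := by exact_mod_cast h4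
    have h5' : (1 : ℝ) ≤ volIn G B (B \ T) := by exact_mod_cast h5
    linarith [volIn_le_vol G B B]
  have hβ0 : (0 : ℝ) < vol G B := by linarith
  have hlogβ : 0.69 ≤ Real.log (vol G B) :=
    le_trans (by linarith [Real.log_two_gt_d9]) (Real.log_le_log (by norm_num) hβ2)
  -- The gap `ψ ≤ 79/80` enters through `log ψ ≤ ψ - 1`.
  have hlogψ : 1 / 80 ≤ Real.log (1 / ψ) := by
    rw [one_div ψ, Real.log_inv]
    linarith [Real.log_le_sub_one_of_pos h0]
  -- the boundary of `B`
  have hbdry : σ₁ * cut G B Bᶜ ≤ ψ * vol G B := by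
    have hcompl : (vol G B : ℝ) ≤ vol G Bᶜ := by
      have h2 : vol G Finset.univ = vol G B + vol G Bᶜ := by
        unfold vol; exact (Finset.sum_add_sum_compl B _).symm
      exact_mod_cast (by omega : vol G B ≤ vol G Bᶜ)
    unfold InternallyConnected conductance at hint
    rw [min_eq_left hcompl, ← mul_div_assoc, div_le_iff₀ hβ0] at hint
    exact hint
  have hsmooth : ∀ T, T ⊆ B → 2 * (volIn G B T : ℝ) ≤ volIn G B B → (cut G T Bᶜ : ℝ) ≤
      1 / (σ₂ * Real.log (vol G B) * Real.log (1 / ψ)) * cut G T (B \ T) := by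
    intro T hT hT2
    have h2 := hsm T hT (by linarith)
    have h3 : 0 < σ₂ * Real.log (vol G B) * Real.log (1 / ψ) := by
      have : 0 < Real.log (vol G B) := by linarith
      have : 0 < Real.log (1 / ψ) := by linarith
      have : 0 < σ₂ := by linarith
      positivity
    rw [one_div_mul_eq_div, le_div_iff₀ h3]
    rw [← hψ] at h2
    linarith
  have hlogβ0 : 0 < Real.log (vol G B) := by linarith
  have hlogψ0 : 0 < Real.log (1 / ψ) := by linarith
  have hσ₁p : 0 < σ₁ := by linarith
  have hσ₂p : 0 < σ₂ := by linarith
  refine ⟨1 / (σ₂ * Real.log (vol G B) * Real.log (1 / ψ)), ?_⟩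
  refine
    { mem := hvs
      φ_pos := hφ
      φ_le := hφ₂
      ψ_le := h1.le
      expand := fun T hT hT2 => setConductance_mul_le G hT hT2
      smooth := hsmooth
      δ_nonneg := by positivity
      δ_le := ?_
      one_le := fun v hv => one_le_volIn_singleton G h0 hv
      half_le := ?_
      two_le := hβ2
      early := ?_
      late := ?_
      η₁_nonneg := by positivity
      η₂_nonneg := by positivity
      leak_le := ?_ }
  -- The summand 1600 of the lower bound on `σ₂` is for this: `1600 · 0.69 / 80 ≥ 10`.
  · rw [div_le_div_iff₀ (by positivity) (by norm_num)]
    have : 1600 * 0.69 * (1 / 80) ≤ σ₂ * Real.log (vol G B) * Real.log (1 / ψ) := by gcongr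
    linarith
  · have h2 := vol_eq_volIn_add_cut G B B
    have h3 : (2 : ℝ) * cut G B Bᶜ ≤ σ₁ * cut G B Bᶜ :=
      mul_le_mul_of_nonneg_right (by linarith) (Nat.cast_nonneg _)
    have h4 : ψ * vol G B ≤ 1 * vol G B := by gcongr
    linarith
  · have h2 : Real.log (1 / φ) ≤ Real.log (1 / c₁) + Real.log (1 / ψ) := by
      rw [← Real.log_mul (by positivity) (by positivity)]
      refine Real.log_le_log (by positivity) ?_
      rw [one_div_mul_one_div]
      exact one_div_le_one_div_of_le (by positivity) hφ₁
    have h3 : 4 + Real.log (1 / φ) ≤ leakConst c₁ * Real.log (1 / ψ) := by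
      have h4 : (80 * (4 + Real.log (1 / c₁))) * (1 / 80) ≤
          (80 * (4 + Real.log (1 / c₁))) * Real.log (1 / ψ) := by gcongr
      unfold leakConst
      linarith
    calc _ ≤ 1 / (σ₂ * Real.log (vol G B) * Real.log (1 / ψ)) *
          (leakConst c₁ * Real.log (1 / ψ)) := by gcongr
      _ = _ := by field_simp
  · rw [div_le_iff₀ hφ]
    have h2 : c₁ * ψ * vol G B ≤ φ * vol G B := by gcongr
    have h3 : 1 / (c₁ * σ₁) * vol G B * φ = φ * vol G B / (c₁ * σ₁) := by ring
    rw [h3, le_div_iff₀ (by positivity)]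
    have h4 := mul_le_mul_of_nonneg_left hbdry hc₁.le
    linarith
  · have h2 : 2 * (leakConst c₁ / σ₂) ≤ 2 * (leakConst c₁ / (16 * leakConst c₁ + 64 / c₁ + 1600)) := by
      gcongr
    have h3 : 8 * (1 / (c₁ * σ₁)) ≤ 8 * (1 / (c₁ * (16 * leakConst c₁ + 64 / c₁ + 1600))) := by
      gcongr
    have h4 : 2 * (leakConst c₁ / (16 * leakConst c₁ + 64 / c₁ + 1600)) +
        8 * (1 / (c₁ * (16 * leakConst c₁ + 64 / c₁ + 1600))) =
        (2 * leakConst c₁ + 8 / c₁) / (16 * leakConst c₁ + 64 / c₁ + 1600) := by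
      have : 16 * leakConst c₁ + 64 / c₁ + 1600 ≠ 0 := by positivity
      generalize 16 * leakConst c₁ + 64 / c₁ + 1600 = x at *
      field_simp
    have h5 : (2 * leakConst c₁ + 8 / c₁) / (16 * leakConst c₁ + 64 / c₁ + 1600) ≤ 1 / 8 := by
      rw [div_le_div_iff₀ (by positivity) (by norm_num)]
      have : 64 / c₁ = 8 * (8 / c₁) := by ring
      linarith
    linarith

end CRD

theorem theorem2 :
    ∃ c₀ : ℝ, 0 < c₀ ∧ ∃ T₀ : ℝ, 0 < T₀ ∧
    ∀ c₁ : ℝ, 0 < c₁ → c₁ ≤ c₀ →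
    ∃ s₀ : ℝ, 0 < s₀ ∧ ∃ K : ℝ, 0 < K ∧
    ∀ (V : Type*) [Fintype V] [DecidableEq V] (G : SimpleGraph V) [DecidableRel G.Adj]
      (adj : V → List V) (_ : CRD.IsAdjacencyList G adj)
      (B : Finset V) (_ : 2 * CRD.vol G B ≤ CRD.vol G Finset.univ)
      (_ : 0 < CRD.setConductance G B) (_ : CRD.setConductance G B < 1)
      (σ₁ σ₂ : ℝ) (_ : s₀ ≤ σ₁) (_ : s₀ ≤ σ₂)
      (_ : CRD.InternallyConnected G B σ₁) (_ : CRD.Smooth G B σ₂)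
      (vs : V) (_ : vs ∈ B)
      (φ : ℝ) (_ : c₁ * CRD.setConductance G B ≤ φ) (_ : φ ≤ c₀ * CRD.setConductance G B)
      (t : ℕ) (_ : T₀ * Real.log ((CRD.vol G B : ℝ) / G.degree vs) ≤ t),
      -- the outcome of every execution
      (∀ (n : ℕ) (m : V → ℝ), CRD.Run G adj vs φ (1 / 2) t n (.done m) →
        (CRD.vol G (CRD.recovered G m \ B) : ℝ) ≤ K / min σ₁ σ₂ * CRD.vol G B ∧
        (CRD.vol G (B \ CRD.recovered G m) : ℝ) ≤ K / min σ₁ σ₂ * CRD.vol G B) ∧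
      -- an execution never gets stuck before it returns
      (∀ (n : ℕ) (j : ℕ) (s : CRD.InnerState V), CRD.Run G adj vs φ (1 / 2) t n (.inner j s) →
        ∃ (k : ℕ) (c : CRD.Config V), CRD.Step G adj vs φ (1 / 2) t (.inner j s) k c) ∧
      -- the running time, for integral edge capacities
      ((∃ k : ℕ, 1 / φ = k) →
        ∀ (n : ℕ) (c : CRD.Config V), CRD.Run G adj vs φ (1 / 2) t n c →
          (n : ℝ) ≤ K * (CRD.vol G B * Real.log (CRD.vol G B) / CRD.setConductance G B)) := by
  -- The value `T₀ = 2` works because `1 / log 2 < 2`.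
  refine ⟨1 / 100, by norm_num, 2, by norm_num, fun c₁ hc₁ hc₁' => ?_⟩
  have hlogc : 0 ≤ Real.log (1 / c₁) := Real.log_nonneg (by
    rw [le_div_iff₀ hc₁]; linarith)
  have hD : 0 < CRD.leakConst c₁ := by unfold CRD.leakConst; positivity
  -- The common part is `8 (2 leakConst c₁ + 8 / c₁)`: in `s₀` it keeps the leaked fraction below
  -- 1/8, in `K` it is the constant for the volume recovered outside `B`. The summand `400 / c₁` is
  -- for the running time.
  refine ⟨16 * CRD.leakConst c₁ + 64 / c₁ + 1600, by positivity,
    16 * CRD.leakConst c₁ + 64 / c₁ + 400 / c₁, by positivity, ?_⟩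
  intro V _ _ G _ adj hadj B hvol h0 h1 σ₁ σ₂ hσ₁ hσ₂ hint hsm vs hvs φ hφ₁ hφ₂ t ht
  obtain ⟨δ, hset⟩ := CRD.exists_setting G hc₁ hc₁' hvol h0 h1 hσ₁ hσ₂ hint hsm hvs hφ₁ hφ₂
  have hinv : ∀ {n : ℕ} {c : CRD.Config V}, CRD.Run G adj vs φ (1 / 2) t n c → _ :=
    fun hrun => hset.configInv_of_run hadj ht hrun
  have hs0 : 0 < 16 * CRD.leakConst c₁ + 64 / c₁ + 1600 := by positivity
  have hσ : 0 < min σ₁ σ₂ := lt_min (by linarith) (by linarith)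
  refine ⟨fun n m hrun => ?_, fun n j s _ => CRD.exists_step G adj vs φ (1 / 2) t j s,
    fun hφ n c hrun => ?_⟩
  · obtain ⟨hS, hB, -⟩ := hinv hrun
    constructor
    · refine hS.trans (mul_le_mul_of_nonneg_right ?_ (Nat.cast_nonneg _))
      have e1 : CRD.leakConst c₁ / σ₂ ≤ CRD.leakConst c₁ / min σ₁ σ₂ := by
        gcongr; exact min_le_right _ _
      have e2 : 1 / (c₁ * σ₁) ≤ 1 / (c₁ * min σ₁ σ₂) := by
        gcongr; exact min_le_left _ _
      calc 8 * (2 * (CRD.leakConst c₁ / σ₂) + 8 * (1 / (c₁ * σ₁)))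
          ≤ 8 * (2 * (CRD.leakConst c₁ / min σ₁ σ₂) + 8 * (1 / (c₁ * min σ₁ σ₂))) := by
            linarith
        _ = (16 * CRD.leakConst c₁ + 64 / c₁) / min σ₁ σ₂ := by
            generalize min σ₁ σ₂ = x at *
            field_simp
            ring
        _ ≤ _ := by
            have : 0 < 400 / c₁ := by positivity
            exact div_le_div_of_nonneg_right (by linarith) hσ.le
    · rw [hB]
      simp only [CRD.vol, Finset.sum_empty, Nat.cast_zero]
      positivity
  · refine ((hinv hrun).time_le hset hφ).trans ((hset.time_le hc₁ h0 hφ₁).trans ?_)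
    refine mul_le_mul_of_nonneg_right ?_ ?_
    · have : 0 < 64 / c₁ := by positivity
      linarith
    · have := Real.log_nonneg (show (1 : ℝ) ≤ CRD.vol G B by linarith [hset.two_le])
      positivity
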